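/- Let $p$ be a prime, $\Gamma=\Gamma_0(p)$, and let $v_\Gamma$ be the hyperbolic area of $\Gamma\backslash\mathbb H$ (for $dx\,dy/y^2$). For a cusp $\mathfrak a$ of $\Gamma$ let $\Gamma_{\mathfrak a}$ be its stabilizer in $\Gamma$ and let $\tau_{\mathfrak a}\in \mathrm{SL}_2(\mathbb R)$ be a scaling matrix: $\tau_{\mathfrak a}\infty=\mathfrak a$ and $\tau_{\mathfrak a}^{-1}\Gamma\tau_{\mathfrak a}\cap\{\left(\begin{smallmatrix}1&x\\0&1\end{smallmatrix}\right):x\in\mathbb R\}=\{\left(\begin{smallmatrix}1&k\\0&1\end{smallmatrix}\right):k\in\mathbb Z\}$. Let $$E_{\Gamma,\mathfrak a}(z,s)=\sum_{\gamma\in\Gamma_{\mathfrak a}\backslash\Gamma}\operatorname{Im}(\tau_{\mathfrak a}^{-1}\gamma z)^s\qquad(\operatorname{Re} s>1),$$ continued meromorphically to $s\in\mathbb C$, and let $$K_{\Gamma,\mathfrak a}(z)=\lim_{s\to1}\Big(E_{\Gamma,\mathfrak a}(z,s)-\frac1{v_\Gamma(s-1)}\Big).$$ Then, for every $z=x+iy\in\mathbb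 H$, the continuations and the limits for the cusps $\infty$ and $0$ exist, and $$K_{\Gamma,\infty}(z)=\frac{3}{(p+1)\pi}\left(2\gamma-2\frac{\zeta'}{\zeta}(2)-\log\left(\frac{4y|\eta(pz)|^{\frac{4p}{p-1}}}{|\eta(z)|^{\frac{4}{p-1}}}\right)-\frac{2p^2\log p}{p^2-1}\right),$$ $$K_{\Gamma,0}(z)=\frac{3}{(p+1)\pi}\left(2\gamma-2\frac{\zeta'}{\zeta}(2)-\log\left(\frac{4y|\eta(z)|^{\frac{4p}{p-1}}}{|\eta(pz)|^{\frac{4}{p-1}}}\right)+\frac{(1+2p-p^2)\log p}{p^2-1}\right),$$ where $\gamma$ in the formulas is Euler's constant, $\zeta$ is the Riemann zeta function, and $\eta$ is the Dedekind eta function. -/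

import Mathlib

open scoped MatrixGroups

/-- The unipotent matrix `n_x = (1 x; 0 1)`. -/
def unipotent (x : ℝ) : SL(2, ℝ) :=
  ⟨!![1, x; 0, 1], by simp⟩

/-- The Hecke congruence group `Γ₀(p)`, as a subgroup of `SL(2, ℝ)`. -/
def gammaZero (p : ℕ) : Subgroup SL(2, ℝ) :=
  (CongruenceSubgroup.Gamma0 p).map (Matrix.SpecialLinearGroup.map (Int.castRingHom ℝ))

/-- The stabilizer `Γ_𝔞` of a boundary point `𝔞 ∈ ℝ ∪ {∞}` in `Γ`, as a subgroup of `Γ`. -/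
noncomputable def cuspStabilizer (Γ : Subgroup SL(2, ℝ)) (a : OnePoint ℝ) : Subgroup Γ :=
  (MulAction.stabilizer (GL (Fin 2) ℝ) a).comap
    (Matrix.SpecialLinearGroup.toGL.comp Γ.subtype)

/-- `τ` is a scaling matrix for the cusp `𝔞` of `Γ`: it maps `∞` to `𝔞`, and the unipotent
matrices `n_x` in `τ⁻¹ Γ τ` are exactly those with `x ∈ ℤ`. -/
structure IsScalingMatrix (Γ : Subgroup SL(2, ℝ)) (a : OnePoint ℝ) (τ : SL(2, ℝ)) : Prop where
  map_infty : (τ : GL (Fin 2) ℝ) • (OnePoint.infty : OnePoint ℝ) = a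
  conj_mem_iff : ∀ x : ℝ, τ * unipotent x * τ⁻¹ ∈ Γ ↔ ∃ k : ℤ, x = k

/-- The index set `Γ_𝔞 \ Γ` of the Eisenstein series. -/
abbrev CuspCosets (Γ : Subgroup SL(2, ℝ)) (a : OnePoint ℝ) : Type :=
  Quotient (QuotientGroup.rightRel (cuspStabilizer Γ a))

/-- The term `Im(τ⁻¹ γ z)^s` of the Eisenstein series at the class of `γ` in `Γ_𝔞 \ Γ`. When `τ`
is a scaling matrix for `𝔞` it does not depend on the representative `γ`, see
`IsScalingMatrix.im_smul_eq`. -/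
noncomputable def eisensteinTerm (Γ : Subgroup SL(2, ℝ)) (a : OnePoint ℝ) (τ : SL(2, ℝ))
    (z : UpperHalfPlane) (s : ℂ) (q : CuspCosets Γ a) : ℂ :=
  ((((τ⁻¹ * (q.out : SL(2, ℝ))) • z : UpperHalfPlane).im : ℝ) : ℂ) ^ s

/-- `E` is a meromorphic continuation to `ℂ` of the Eisenstein series
`E_{Γ,𝔞}(z,s) = ∑_{γ ∈ Γ_𝔞 \ Γ} Im(τ⁻¹ γ z)^s`, `Re s > 1` (in the variable `s`, for fixed `z`). -/
structure IsEisensteinContinuation (Γ : Subgroup SL(2, ℝ)) (a : OnePoint ℝ) (τ : SL(2, ℝ))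
    (z : UpperHalfPlane) (E : ℂ → ℂ) : Prop where
  meromorphic : MeromorphicOn E Set.univ
  hasSum : ∀ s : ℂ, 1 < s.re → HasSum (eisensteinTerm Γ a τ z s) (E s)

/-- The hyperbolic area `v_Γ` of `Γ \ ℍ`: the area of a fundamental domain, for the measure
`dx dy / y²`, of the group of transformations of `ℍ` induced by `Γ`. (One passes to the group of
transformations because `-1` acts trivially on `ℍ`.) -/
noncomputable def hyperbolicArea (Γ : Subgroup SL(2, ℝ)) : ℝ :=
  (MeasureTheory.covolume (Γ.map (MulAction.toPermHom SL(2, ℝ) UpperHalfPlane))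
    UpperHalfPlane).toReal

/-- `K` is the Kronecker limit of `Γ` for the cusp `𝔞` at `z`: the (meromorphically continued)
Eisenstein series satisfies `E_{Γ,𝔞}(z,s) - 1 / (v_Γ (s - 1)) → K` as `s → 1` in `ℂ`. Scaling
matrices for `𝔞` are required to exist, and the limit is required for every choice of one. -/
def HasKroneckerLimit (Γ : Subgroup SL(2, ℝ)) (a : OnePoint ℝ) (z : UpperHalfPlane) (K : ℂ) :
    Prop :=
  (∃ τ : SL(2, ℝ), IsScalingMatrix Γ a τ) ∧
    ∀ τ : SL(2, ℝ), IsScalingMatrix Γ a τ →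
      ∃ E : ℂ → ℂ, IsEisensteinContinuation Γ a τ z E ∧
        Filter.Tendsto (fun s : ℂ => E s - 1 / ((hyperbolicArea Γ : ℂ) * (s - 1)))
          (nhdsWithin 1 {1}ᶜ) (nhds K)

/-- The terms of the Eisenstein series are well defined on `Γ_𝔞 \ Γ`. -/
theorem IsScalingMatrix.im_smul_eq {Γ : Subgroup SL(2, ℝ)} {a : OnePoint ℝ} {τ : SL(2, ℝ)}
    (hτ : IsScalingMatrix Γ a τ) (δ : Γ) (hδ : δ ∈ cuspStabilizer Γ a) (γ : SL(2, ℝ))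
    (z : UpperHalfPlane) :
    ((τ⁻¹ * (δ * γ)) • z : UpperHalfPlane).im = ((τ⁻¹ * γ) • z : UpperHalfPlane).im := by
  obtain ⟨g, hg⟩ : ∃ g : SL(2, ℝ), g = τ⁻¹ * δ * τ := ⟨_, rfl⟩
  have hδa : ((δ : SL(2, ℝ)) : GL (Fin 2) ℝ) • a = a := hδ
  have hfix : (g : GL (Fin 2) ℝ) • (OnePoint.infty : OnePoint ℝ) = OnePoint.infty := by
    rw [hg, map_mul, map_mul, mul_smul, mul_smul, hτ.map_infty, hδa, map_inv, inv_smul_eq_iff,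
      hτ.map_infty]
  have hc : g 1 0 = 0 := by
    have := OnePoint.smul_infty_eq_self_iff.mp hfix
    simpa using this
  have hdet : g 0 0 * g 1 1 = 1 := by
    have := g.det_coe
    rw [Matrix.det_fin_two, hc] at this
    linarith
  have hmem : ∀ x y : ℝ, g * unipotent x = unipotent y * g → (∃ k : ℤ, x = k) →
      ∃ k : ℤ, y = k := by
    intro x y hxy hx
    rw [← hτ.conj_mem_iff] at hx ⊢
    have h1 := Γ.mul_mem (Γ.mul_mem δ.2 hx) (Γ.inv_mem δ.2)
    have h2 : unipotent y = g * unipotent x * g⁻¹ := by rw [hxy]; group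
    rw [h2, hg]
    convert h1 using 1
    group
  have hmem' : ∀ x y : ℝ, g * unipotent x = unipotent y * g → (∃ k : ℤ, y = k) →
      ∃ k : ℤ, x = k := by
    intro x y hxy hy
    rw [← hτ.conj_mem_iff] at hy ⊢
    have h1 := Γ.mul_mem (Γ.mul_mem (Γ.inv_mem δ.2) hy) δ.2
    have h2 : unipotent x = g⁻¹ * unipotent y * g := by rw [mul_assoc, ← hxy]; group
    rw [h2, hg]
    convert h1 using 1
    group
  have hcomm : ∀ x y : ℝ, g 0 0 * x = y * g 1 1 → g * unipotent x = unipotent y * g := by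
    intro x y hxy
    apply Subtype.ext
    rw [Matrix.SpecialLinearGroup.coe_mul, Matrix.SpecialLinearGroup.coe_mul]
    ext i j
    rw [Matrix.mul_apply, Matrix.mul_apply, Fin.sum_univ_two, Fin.sum_univ_two]
    fin_cases i <;> fin_cases j <;> simp [unipotent, hc]
    linarith
  have h11 : g 1 1 ^ 2 = 1 := by
    obtain ⟨k, hk⟩ := hmem 1 (g 0 0 ^ 2) (hcomm _ _ (by linear_combination (-g 0 0) * hdet))
      ⟨1, by simp⟩
    obtain ⟨l, hl⟩ := hmem' (g 1 1 ^ 2) 1 (hcomm _ _ (by linear_combination (g 1 1) * hdet))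
      ⟨1, by simp⟩
    have hkl : (l : ℝ) * k = 1 := by
      rw [← hk, ← hl]; linear_combination (g 0 0 * g 1 1 + 1) * hdet
    have hl0 : 0 ≤ l := by
      have : (0 : ℝ) ≤ l := by rw [← hl]; positivity
      exact_mod_cast this
    have hl1 : l = 1 := Int.eq_one_of_mul_eq_one_right hl0 (by exact_mod_cast hkl)
    rw [hl, hl1]; simp
  have hz : (τ⁻¹ * (δ * γ)) • z = g • ((τ⁻¹ * γ) • z) := by
    rw [← mul_smul, hg]; congr 1; group
  rw [hz]
  change (Matrix.SpecialLinearGroup.mapGL ℝ g • ((τ⁻¹ * γ) • z)).im = _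
  rw [UpperHalfPlane.im_smul_eq_div_normSq]
  have hn : Complex.normSq (UpperHalfPlane.denom (Matrix.SpecialLinearGroup.mapGL ℝ g)
      (((τ⁻¹ * γ) • z : UpperHalfPlane) : ℂ)) = 1 := by
    simp [UpperHalfPlane.denom, hc]
    nlinarith
  rw [hn]
  simp

/-! Write `Z(z, s)` for the Epstein zeta function `∑ (y / |m z + n|²) ^ s` over nonzero `(m, n)`.
The classes in `Γ_∞ \ Γ₀(p)` are the bottom rows `(c, d)`, coprime with `p ∣ c`, up to sign, so
`E_∞` is half the sum of `(y / |c z + d|²) ^ s` over such rows. Removing the common factor of `(m,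
n)` costs `ζ(2s)`. The condition `p ∣ c` is isolated by comparing the coprime sums at `z` and at `p
z`: if `F`, `G` are these sums and `A` is the part of `F` with `p ∣ c`, then `G = p ^ s A + p ^ (-s)
(F - A)` (`hasSum_dvd_fst_of_hasSum`). Hence `E_∞(z, s) = (p ^ s Z(p z, s) - Z(z, s)) / (2 ζ(2s) (p
^ (2s) - 1))`.

The analytic input is Kronecker's first limit formula for `Z` (`tendsto_epsteinZeta_sub`). The theta
functional equation continues `Z` and shows that `Z - π / (s - 1)` has some limit at `1`, which may
therefore be computed along real `s ↓ 1`. There the lattice is summed by rows. The row `m = 0` gives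
`ζ(2s)`. Every other row is compared with an integral: the integrals add up to a Gamma factor times
`ζ(2s - 1)`, which produces the pole and Euler's constant, while the errors are `O(m⁻²)` uniformly
in `s`, so one may put `s = 1` in them. At `s = 1` the cotangent expansion evaluates them as Lambert
series, and these sum to `log |η|`.

Since `v_Γ = (p + 1) π / 3` (`hyperbolicArea_gammaZero`, by tiling with `p + 1` copies of the
modular domain), expanding the quotient at `s = 1` gives the limit for `∞`. The Fricke involution `z
↦ -1 / (p z)` normalizes `Γ₀(p)` and takes `∞` to `0`; as `Z` is invariant under `z ↦ -1 / z`,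
passing to the cusp `0` only exchanges `Z(z, s)` and `Z(p z, s)`. -/

section

open scoped MatrixGroups Modular Pointwise
open MeasureTheory Filter Topology Asymptotics

/-! ### Hyperbolic area of the modular fundamental domain -/

lemma lintegral_Ici_inv_sq {a : ℝ} (ha : 0 < a) :
    ∫⁻ y in Set.Ici a, ENNReal.ofReal (1 / y ^ 2) = ENNReal.ofReal (1 / a) := by
  rw [← setLIntegral_congr (Ioi_ae_eq_Ici (μ := volume))]
  have h2 : ∀ y ∈ Set.Ioi a, 1 / y ^ 2 = y ^ (-2 : ℝ) := by
    intro y hy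
    rw [Real.rpow_neg (ha.trans hy).le]
    norm_num
  rw [setLIntegral_congr_fun measurableSet_Ioi (g := fun y => ENNReal.ofReal (y ^ (-2 : ℝ)))
    (fun y hy => by simp only [h2 y hy]),
    ← ofReal_integral_eq_lintegral_ofReal (integrableOn_Ioi_rpow_of_lt (by norm_num) ha),
    integral_Ioi_rpow_of_lt (by norm_num) ha]
  · norm_num [Real.rpow_neg_one]
  · filter_upwards [ae_restrict_mem measurableSet_Ioi] with y hy
    exact Real.rpow_nonneg (ha.trans hy).le _

lemma lintegral_inv_sqrt_one_sub_sq :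
    ∫⁻ x in Set.Icc (-1 / 2 : ℝ) (1 / 2), ENNReal.ofReal (1 / √(1 - x ^ 2)) =
      ENNReal.ofReal (Real.pi / 3) := by
  have hpos : ∀ x ∈ Set.Icc (-1 / 2 : ℝ) (1 / 2), 0 < 1 - x ^ 2 := fun x hx => by
    nlinarith [hx.1, hx.2]
  have hc : ContinuousOn (fun x : ℝ => 1 / √(1 - x ^ 2)) (Set.Icc (-1 / 2 : ℝ) (1 / 2)) := by
    apply ContinuousOn.div continuousOn_const (by fun_prop)
    intro x hx
    exact (Real.sqrt_pos.mpr (hpos x hx)).ne'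
  rw [← ofReal_integral_eq_lintegral_ofReal (hc.integrableOn_Icc)]
  · congr 1
    rw [integral_Icc_eq_integral_Ioc, ← intervalIntegral.integral_of_le (by norm_num),
      intervalIntegral.integral_eq_sub_of_hasDerivAt (f := Real.arcsin)]
    · have h := Real.arcsin_sin (x := Real.pi / 6) (by linarith [Real.pi_pos])
        (by linarith [Real.pi_pos])
      rw [Real.sin_pi_div_six] at h
      rw [neg_div, Real.arcsin_neg, h]
      ring
    · intro x hx
      rw [Set.uIcc_of_le (by norm_num)] at hx
      exact Real.hasDerivAt_arcsin (by linarith [hx.1]) (by linarith [hx.2])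
    · apply ContinuousOn.intervalIntegrable
      rwa [Set.uIcc_of_le (by norm_num)]
  · filter_upwards with x
    positivity

/-- Integrate over `y` first: above a fixed `|x| ≤ 1 / 2` the domain is the ray `y ≥ √(1 - x²)`,
which contributes `1 / √(1 - x²)`, the derivative of `arcsin`. -/
lemma volume_modularGroup_fd : volume (𝒟 : Set UpperHalfPlane) = ENNReal.ofReal (Real.pi / 3) := by
  rw [UpperHalfPlane.volume_eq_lintegral, ModularGroup.coe_fd]
  set S : Set ℂ := {z : ℂ | 0 < z.im ∧ 1 ≤ ‖z‖ ∧ |z.re| ≤ 1 / 2} with hS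
  have hSm : MeasurableSet S := by
    have h : IsClosed {z : ℂ | |z.re| ≤ 1 / 2} := isClosed_le (by fun_prop) (by fun_prop)
    exact (measurableSet_lt measurable_const Complex.measurable_im).inter
      ((measurableSet_le measurable_const measurable_norm).inter h.measurableSet)
  have hf : Measurable (fun z : ℂ => ENNReal.ofReal (1 / z.im ^ 2)) := by fun_prop
  have h1 : ∀ z : ℂ, (((1 / ‖z.im‖₊) ^ 2 : NNReal) : ENNReal) = ENNReal.ofReal (1 / z.im ^ 2) := by
    intro z
    rw [ENNReal.ofReal, ENNReal.coe_inj]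
    ext
    rw [Real.coe_toNNReal _ (by positivity)]
    simp
  simp_rw [h1]
  have hm : Measurable (fun a : ℝ × ℝ => S.indicator (fun z => ENNReal.ofReal (1 / z.im ^ 2))
      (Complex.measurableEquivRealProd.symm a)) :=
    (hf.indicator hSm).comp Complex.measurableEquivRealProd.symm.measurable
  rw [← lintegral_indicator hSm,
    ← (Complex.volume_preserving_equiv_real_prod.symm).lintegral_comp (hf.indicator hSm),
    Measure.volume_eq_prod, lintegral_prod _ hm.aemeasurable,
    ← lintegral_inv_sqrt_one_sub_sq, ← lintegral_indicator measurableSet_Icc]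
  congr 1
  ext x
  by_cases hx : x ∈ Set.Icc (-1 / 2 : ℝ) (1 / 2)
  · have hpos : 0 < 1 - x ^ 2 := by nlinarith [hx.1, hx.2]
    rw [Set.indicator_of_mem hx, ← lintegral_Ici_inv_sq (Real.sqrt_pos.mpr hpos),
      ← lintegral_indicator measurableSet_Ici]
    congr 1
    ext y
    have : (Complex.measurableEquivRealProd.symm (x, y) ∈ S) ↔ y ∈ Set.Ici (√(1 - x ^ 2)) := by
      have hx' : |x| ≤ 1 / 2 := abs_le.mpr ⟨by linarith [hx.1], hx.2⟩
      simp only [hS, Complex.measurableEquivRealProd_symm_apply, Set.mem_ofPred_eq, Set.mem_Ici,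
        Complex.norm_def, Complex.normSq_mk, Real.one_le_sqrt]
      constructor
      · rintro ⟨h0, h, -⟩
        rw [Real.sqrt_le_left h0.le]
        nlinarith
      · intro h
        have h0 : 0 < y := (Real.sqrt_pos.mpr hpos).trans_le h
        rw [Real.sqrt_le_left h0.le] at h
        exact ⟨h0, by nlinarith, hx'⟩
    by_cases hy : y ∈ Set.Ici (√(1 - x ^ 2))
    · rw [Set.indicator_of_mem hy, Set.indicator_of_mem (this.mpr hy)]
      simp
    · rw [Set.indicator_of_notMem hy, Set.indicator_of_notMem (fun h => hy (this.mp h))]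
  · rw [Set.indicator_of_notMem hx]
    refine (lintegral_congr fun y => ?_).trans lintegral_zero
    apply Set.indicator_of_notMem
    rintro ⟨-, -, h⟩
    have h' : |x| ≤ 1 / 2 := h
    exact hx ⟨by linarith [(abs_le.mp h').1], (abs_le.mp h').2⟩

lemma volume_modularGroup_fd_sdiff_fdo : volume (𝒟 \ 𝒟ᵒ : Set UpperHalfPlane) = 0 := by
  rw [UpperHalfPlane.volume_eq_lintegral]
  apply setLIntegral_measure_zero
  have hline : ∀ c : ℝ, volume {z : ℂ | z.re = c} = 0 := by
    intro c
    rw [← (Complex.volume_preserving_equiv_real_prod.symm).measure_preimage_equiv]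
    have : (Complex.measurableEquivRealProd.symm ⁻¹' {z : ℂ | z.re = c}) = {c} ×ˢ Set.univ := by
      ext ⟨x, y⟩
      simp
    rw [this, Measure.volume_eq_prod, Measure.prod_prod]
    simp
  refine measure_mono_null (t := Metric.sphere (0 : ℂ) 1 ∪ ({z : ℂ | z.re = 1 / 2} ∪
    {z : ℂ | z.re = -(1 / 2)})) ?_ (measure_union_null (Measure.addHaar_sphere _ _ _)
      (measure_union_null (hline _) (hline _)))
  rintro _ ⟨z, ⟨⟨h1, h2⟩, h3⟩, rfl⟩
  by_cases hn : Complex.normSq (z : ℂ) = 1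
  · left
    simp [Complex.norm_def, hn]
  · right
    have : ¬ |z.re| < 1 / 2 := fun h => h3 ⟨lt_of_le_of_ne h1 (Ne.symm hn), h⟩
    have := le_antisymm h2 (not_lt.mp this)
    rcases (abs_eq (by norm_num)).mp this with h | h
    · left; exact h
    · right; exact h

instance UpperHalfPlane.smulInvariantMeasure_specialLinearGroup {R : Type*} [CommRing R]
    [Algebra R ℝ] : SMulInvariantMeasure SL(2, R) UpperHalfPlane volume :=
  ⟨fun g _ hs => measure_preimage_smul_of_nullMeasurableSet
    (G := GL (Fin 2) ℝ) hs.nullMeasurableSet (Matrix.SpecialLinearGroup.mapGL ℝ g)⟩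

instance UpperHalfPlane.measurableConstSMul_specialLinearGroup {R : Type*} [CommRing R]
    [Algebra R ℝ] : MeasurableConstSMul SL(2, R) UpperHalfPlane :=
  ⟨fun g => measurable_const_smul (M := GL (Fin 2) ℝ) (Matrix.SpecialLinearGroup.mapGL ℝ g)⟩

/-- A point of `𝒟ᵒ` that an element takes into `𝒟` forces this element to be `±1`. The overlap
therefore lies in the boundary, which is contained in a circle and two lines. -/
lemma aedisjoint_smul_modularGroup_fd {g : SL(2, ℤ)} (h1 : g ≠ 1) (h2 : g ≠ -1) :
    AEDisjoint volume (g • 𝒟) (𝒟 : Set UpperHalfPlane) := by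
  refine measure_mono_null ?_ volume_modularGroup_fd_sdiff_fdo
  rintro w ⟨hw, hwD⟩
  refine ⟨hwD, fun hwo => ?_⟩
  rw [Set.mem_smul_set_iff_inv_smul_mem] at hw
  rcases ModularGroup.eq_one_or_neg_one_of_mem_fdo_mem_fd hwo hw with h | h
  · exact h1 (inv_eq_one.mp h)
  · exact h2 (by rw [← inv_inv g, h]; rw [inv_eq_iff_mul_eq_one]; simp)

lemma aedisjoint_smul_smul_modularGroup_fd {g h : SL(2, ℤ)} (h1 : g ≠ h) (h2 : g ≠ -h) :
    AEDisjoint volume (g • 𝒟) (h • 𝒟 : Set UpperHalfPlane) := by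
  have := aedisjoint_smul_modularGroup_fd (g := h⁻¹ * g) (by rwa [ne_eq, inv_mul_eq_one, eq_comm])
    (by rw [ne_eq, inv_mul_eq_iff_eq_mul]; simpa using h2)
  have h3 : (g • 𝒟 ∩ h • 𝒟 : Set UpperHalfPlane) = h • ((h⁻¹ * g) • 𝒟 ∩ 𝒟) := by
    rw [Set.smul_set_inter, smul_smul, mul_inv_cancel_left]
  rw [AEDisjoint, h3, measure_smul]
  exact this

/-! ### Fundamental domains and covolumes of subgroups of the modular group -/

/-- The transformation of the upper half-plane induced by an element of `SL(2, ℤ)`. -/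
lemma toPermHom_map_int_smul (g : SL(2, ℤ)) (z : UpperHalfPlane) :
    MulAction.toPermHom SL(2, ℝ) UpperHalfPlane
      (Matrix.SpecialLinearGroup.map (Int.castRingHom ℝ) g) • z = g • z := by
  change (Matrix.SpecialLinearGroup.map (Int.castRingHom ℝ) g) • z = g • z
  ext
  rw [UpperHalfPlane.coe_specialLinearGroup_apply, UpperHalfPlane.coe_specialLinearGroup_apply]
  simp

/-- The group of transformations of `ℍ` induced by a subgroup of `SL(2, ℤ)`. -/
noncomputable abbrev inducedTransformations (Γ : Subgroup SL(2, ℤ)) : Subgroup (Equiv.Perm UpperHalfPlane) :=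
  (Γ.map (Matrix.SpecialLinearGroup.map (Int.castRingHom ℝ))).map
    (MulAction.toPermHom SL(2, ℝ) UpperHalfPlane)

lemma exists_smul_eq_of_inducedTransformations {Γ : Subgroup SL(2, ℤ)}
    (h : inducedTransformations Γ) :
    ∃ γ ∈ Γ, ∀ z : UpperHalfPlane, h • z = γ • z := by
  obtain ⟨_, _, ⟨γ, hγ, rfl⟩, rfl⟩ := h
  exact ⟨γ, hγ, toPermHom_map_int_smul γ⟩

lemma exists_inducedTransformations_smul_eq {Γ : Subgroup SL(2, ℤ)} {γ : SL(2, ℤ)} (hγ : γ ∈ Γ) :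
    ∃ h : inducedTransformations Γ, ∀ z : UpperHalfPlane, h • z = γ • z :=
  ⟨⟨_, _, ⟨γ, hγ, rfl⟩, rfl⟩, toPermHom_map_int_smul γ⟩

instance (Γ : Subgroup SL(2, ℤ)) : MeasurableConstSMul (inducedTransformations Γ) UpperHalfPlane :=
  ⟨fun h => by
    obtain ⟨γ, -, hγ⟩ := exists_smul_eq_of_inducedTransformations h
    simp_rw [hγ]
    exact measurable_const_smul γ⟩

instance (Γ : Subgroup SL(2, ℤ)) :
    SMulInvariantMeasure (inducedTransformations Γ) UpperHalfPlane volume :=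
  ⟨fun h s hs => by
    obtain ⟨γ, -, hγ⟩ := exists_smul_eq_of_inducedTransformations h
    simp_rw [hγ]
    exact SMulInvariantMeasure.measure_preimage_smul γ hs⟩

instance (Γ : Subgroup SL(2, ℤ)) : Countable (inducedTransformations Γ) := by
  have : Countable (Matrix (Fin 2) (Fin 2) ℤ) := inferInstanceAs (Countable (Fin 2 → Fin 2 → ℤ))
  have : Countable SL(2, ℤ) := Subtype.countable
  have : Countable Γ := Subtype.countable
  refine Function.Surjective.countable (α := Γ) (f := fun γ => ⟨_, _, ⟨γ.1, γ.2, rfl⟩, rfl⟩) ?_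
  rintro ⟨_, _, ⟨γ, hγ, rfl⟩, rfl⟩
  exact ⟨⟨γ, hγ⟩, rfl⟩

section cosets

variable {Γ : Subgroup SL(2, ℤ)} {ι : Type*} {r : ι → SL(2, ℤ)}

/-- The hypothesis on `r` says that the cosets `Γ r i` partition the group; as `-1 ∈ Γ`, the
matrices `r j` and `-r j` lie in the same one. -/
lemma coset_representative_eq (hneg : -1 ∈ Γ) (hr : ∀ g, ∃! i, g * (r i)⁻¹ ∈ Γ) {γ : SL(2, ℤ)}
    (hγ : γ ∈ Γ) {i j : ι} (h : γ * r i = r j ∨ γ * r i = -r j) : i = j ∧ (γ = 1 ∨ γ = -1) := by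
  have h1 : r j * (r i)⁻¹ ∈ Γ := by
    rcases h with h | h
    · rw [← h, mul_inv_cancel_right]; exact hγ
    · have := Γ.mul_mem hneg hγ
      rw [← neg_eq_iff_eq_neg] at h
      rw [← h]
      simpa using this
  have hij : i = j := (hr (r j)).unique h1 (by simp)
  subst hij
  refine ⟨rfl, ?_⟩
  rcases h with h | h
  · left; simpa using h
  · right
    have := congrArg (· * (r i)⁻¹) h
    simpa using this

/-- If `g z ∈ 𝒟` and `g⁻¹ = γ r i` with `γ ∈ Γ`, then `γ⁻¹ z ∈ r i 𝒟`, so the translates cover. Two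
translates can overlap essentially only if `γ r i = ± r j`, which forces `γ = ±1`. -/
lemma isFundamentalDomain_iUnion_smul_modularGroup_fd [Fintype ι] (hneg : -1 ∈ Γ)
    (hr : ∀ g, ∃! i, g * (r i)⁻¹ ∈ Γ) :
    IsFundamentalDomain (inducedTransformations Γ) (⋃ i, r i • (𝒟 : Set UpperHalfPlane)) := by
  refine IsFundamentalDomain.mk'' ?_ ?_ ?_ (fun h => (measurePreserving_smul h _).quasiMeasurePreserving)
  · exact (MeasurableSet.iUnion fun i =>
      ModularGroup.isClosed_fd.measurableSet.const_smul (r i)).nullMeasurableSet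
  · filter_upwards with z
    obtain ⟨g, hg⟩ := ModularGroup.exists_smul_mem_fd z
    obtain ⟨i, hi, -⟩ := hr g⁻¹
    obtain ⟨h, hh⟩ := exists_inducedTransformations_smul_eq (Γ.inv_mem hi)
    refine ⟨h, Set.mem_iUnion.mpr ⟨i, ?_⟩⟩
    rw [hh, Set.mem_smul_set_iff_inv_smul_mem, smul_smul]
    simpa using hg
  · intro h hh
    obtain ⟨γ, hγ, hs⟩ := exists_smul_eq_of_inducedTransformations h
    -- Both `1` and `-1` induce the identity, so a nontrivial transformation comes from neither.
    have h1 : γ ≠ 1 := fun h1 => hh (Subtype.ext (Equiv.ext fun z => by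
      simpa [h1] using! hs z))
    have h2 : γ ≠ -1 := fun h1 => hh (Subtype.ext (Equiv.ext fun z => by
      simpa [h1] using! hs z))
    have : h • (⋃ i, r i • (𝒟 : Set UpperHalfPlane)) = ⋃ i, (γ * r i) • (𝒟 : Set UpperHalfPlane) := by
      rw [Set.smul_set_iUnion]
      refine Set.iUnion_congr fun i => ?_
      rw [mul_smul]
      exact Set.image_congr fun z _ => hs z
    rw [this, AEDisjoint.iUnion_left_iff]
    intro i
    rw [AEDisjoint.iUnion_right_iff]
    intro j
    refine aedisjoint_smul_smul_modularGroup_fd (fun h => ?_) (fun h => ?_)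
    · rcases (coset_representative_eq hneg hr hγ (Or.inl h)).2 with h | h
      exacts [h1 h, h2 h]
    · rcases (coset_representative_eq hneg hr hγ (Or.inr h)).2 with h | h
      exacts [h1 h, h2 h]

lemma covolume_inducedTransformations [Fintype ι] (hneg : -1 ∈ Γ)
    (hr : ∀ g, ∃! i, g * (r i)⁻¹ ∈ Γ) :
    covolume (inducedTransformations Γ) UpperHalfPlane =
      Fintype.card ι * ENNReal.ofReal (Real.pi / 3) := by
  rw [(isFundamentalDomain_iUnion_smul_modularGroup_fd hneg hr).covolume_eq_volume,
    measure_iUnion₀]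
  · simp [measure_smul, volume_modularGroup_fd]
  · intro i j hij
    refine aedisjoint_smul_smul_modularGroup_fd (fun h => hij ?_) (fun h => hij ?_)
    · exact (coset_representative_eq hneg hr Γ.one_mem (Or.inl (by simpa using h))).1
    · exact (coset_representative_eq hneg hr Γ.one_mem (Or.inr (by simpa using h))).1
  · exact fun i => (ModularGroup.isClosed_fd.measurableSet.const_smul (r i)).nullMeasurableSet

end cosets

/-- Representatives of the cosets of `Γ₀(p)` in `SL(2, ℤ)`. -/
def gammaZeroRepresentative (p : ℕ) : Option (ZMod p) → SL(2, ℤ)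
  | none => 1
  | some j => ⟨!![0, -1; 1, (j.val : ℤ)], by simp⟩

/-- A coset of `Γ₀(p)` is a point `(c : d)` of the projective line over `ZMod p`: `none` is the
point `c = 0`, and `some j` is the point `d / c = j`. -/
lemma existsUnique_coset_representative_Gamma0 {p : ℕ} [Fact p.Prime] (g : SL(2, ℤ)) :
    ∃! i : Option (ZMod p), g * (gammaZeroRepresentative p i)⁻¹ ∈
      CongruenceSubgroup.Gamma0 p := by
  have h1 : ∀ j : ZMod p, g * (gammaZeroRepresentative p (some j))⁻¹ ∈
      CongruenceSubgroup.Gamma0 p ↔ ((g 1 0 : ℤ) : ZMod p) * j = (g 1 1 : ℤ) := by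
    intro j
    rw [CongruenceSubgroup.Gamma0_mem, ← sub_eq_zero (b := ((g 1 1 : ℤ) : ZMod p))]
    rw [Matrix.SpecialLinearGroup.coe_mul, Matrix.mul_apply, Fin.sum_univ_two,
      Matrix.SpecialLinearGroup.SL2_inv_expl]
    simp [gammaZeroRepresentative, sub_eq_add_neg]
  have h2 : g * (gammaZeroRepresentative p none)⁻¹ ∈ CongruenceSubgroup.Gamma0 p ↔ ((g 1 0 : ℤ) : ZMod p) = 0 := by
    rw [gammaZeroRepresentative, inv_one, mul_one, CongruenceSubgroup.Gamma0_mem]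
  have hdet : ((g 0 0 : ℤ) : ZMod p) * (g 1 1 : ℤ) - (g 0 1 : ℤ) * (g 1 0 : ℤ) = 1 := by
    have := congrArg (Int.cast : ℤ → ZMod p) (g.det_coe)
    rw [Matrix.det_fin_two] at this
    simpa using this
  by_cases hc : ((g 1 0 : ℤ) : ZMod p) = 0
  · refine ⟨none, h2.mpr hc, ?_⟩
    rintro (_ | j) hj
    · rfl
    · exfalso
      have := (h1 j).mp hj
      rw [hc, zero_mul] at this
      rw [hc, ← this] at hdet
      simp at hdet
  · refine ⟨some (((g 1 1 : ℤ) : ZMod p) / (g 1 0 : ℤ)), (h1 _).mpr (by rw [mul_comm, div_mul_cancel₀ _ hc]), ?_⟩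
    rintro (_ | j) hj
    · exact absurd (h2.mp hj) hc
    · have := (h1 j).mp hj
      congr 1
      rw [← this, mul_div_cancel_left₀ _ hc]

/-- The hyperbolic area of `Γ₀(p) \ ℍ`. -/
lemma hyperbolicArea_gammaZero {p : ℕ} (hp : p.Prime) :
    hyperbolicArea (gammaZero p) = (p + 1) * Real.pi / 3 := by
  have := Fact.mk hp
  have h := covolume_inducedTransformations (Γ := CongruenceSubgroup.Gamma0 p)
    (by simp [CongruenceSubgroup.Gamma0_mem]) existsUnique_coset_representative_Gamma0
  rw [hyperbolicArea, gammaZero, h, ENNReal.toReal_mul, ENNReal.toReal_ofReal (by positivity)]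
  rw [ENNReal.toReal_natCast, Fintype.card_option, ZMod.card]
  push_cast
  ring

/-! ### The theta series of the lattice and its functional equation -/

/-- The positive definite form `|m z + n|² / Im z`. -/
noncomputable def latticeForm (z : UpperHalfPlane) (v : ℤ × ℤ) : ℝ :=
  Complex.normSq (v.1 * z + v.2) / z.im

lemma latticeForm_eq (z : UpperHalfPlane) (v : ℤ × ℤ) :
    latticeForm z v = ((v.1 * z.re + v.2) ^ 2 + (v.1 * z.im) ^ 2) / z.im := by
  rw [latticeForm, Complex.normSq_apply]
  simp
  ring

lemma latticeForm_nonneg (z : UpperHalfPlane) (v : ℤ × ℤ) : 0 ≤ latticeForm z v :=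
  div_nonneg (Complex.normSq_nonneg _) z.im_pos.le

lemma latticeForm_zero (z : UpperHalfPlane) : latticeForm z 0 = 0 := by simp [latticeForm]

lemma latticeForm_pos (z : UpperHalfPlane) {v : ℤ × ℤ} (hv : v ≠ 0) : 0 < latticeForm z v := by
  rw [latticeForm_eq]
  refine div_pos ?_ z.im_pos
  by_cases h : v.1 = 0
  · have h2 : v.2 ≠ 0 := fun h2 => hv (Prod.ext h h2)
    have : (0 : ℝ) < (v.2 : ℝ) ^ 2 := by positivity
    simpa [h] using this
  · have := z.im_pos
    have : (0 : ℝ) < (v.1 * z.im) ^ 2 := by positivity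
    positivity

lemma summable_latticeForm_rpow (z : UpperHalfPlane) {k : ℝ} (hk : 1 < k) :
    Summable fun v : ℤ × ℤ => latticeForm z v ^ (-k) := by
  have h := (EisensteinSeries.summable_one_div_norm_rpow (k := 2 * k) (by linarith)).mul_left
    (z.im ^ k * (EisensteinSeries.r z) ^ (-(2 * k)))
  rw [← (finTwoArrowEquiv ℤ).symm.summable_iff] at h
  refine h.of_nonneg_of_le (fun v => Real.rpow_nonneg (latticeForm_nonneg z v) _) (fun v => ?_)
  have h2 := EisensteinSeries.summand_bound z (k := 2 * k) (by linarith)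
    ((finTwoArrowEquiv ℤ).symm v)
  have h3 : latticeForm z v ^ (-k) = z.im ^ k * ‖(v.1 : ℂ) * z + v.2‖ ^ (-(2 * k)) := by
    rw [latticeForm, Real.div_rpow (Complex.normSq_nonneg _) z.im_pos.le,
      Complex.normSq_eq_norm_sq, ← Real.rpow_natCast, ← Real.rpow_mul (norm_nonneg _),
      Real.rpow_neg z.im_pos.le, div_inv_eq_mul, mul_comm]
    congr 2
    push_cast
    ring
  simp only [Function.comp_apply]
  rw [h3, mul_assoc]
  exact mul_le_mul_of_nonneg_left h2 (Real.rpow_nonneg z.im_pos.le _)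

lemma Real.exp_neg_le_factorial_mul_inv_pow (n : ℕ) {x : ℝ} (hx : 0 < x) :
    Real.exp (-x) ≤ n.factorial * (x ^ n)⁻¹ := by
  rw [Real.exp_neg, ← div_eq_mul_inv, inv_le_comm₀ (Real.exp_pos x) (by positivity), inv_div]
  exact Real.pow_div_factorial_le_exp x hx.le n

/-- The summands of the theta series without its constant term. -/
noncomputable def thetaTerm (z : UpperHalfPlane) (t : ℝ) (v : ℤ × ℤ) : ℝ :=
  (if v = 0 then 0 else 1) * Real.exp (-(Real.pi * latticeForm z v) * t)

lemma thetaTerm_nonneg (z : UpperHalfPlane) (t : ℝ) (v : ℤ × ℤ) : 0 ≤ thetaTerm z t v := by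
  rw [thetaTerm]
  split_ifs <;> positivity

lemma thetaTerm_le (z : UpperHalfPlane) {t : ℝ} (ht : 0 < t) (n : ℕ) (v : ℤ × ℤ) :
    thetaTerm z t v ≤ n.factorial * ((Real.pi * t) ^ n)⁻¹ * latticeForm z v ^ (-(n : ℝ)) := by
  rw [thetaTerm]
  have hn := Real.rpow_nonneg (latticeForm_nonneg z v) (-(n : ℝ))
  split_ifs with h
  · rw [zero_mul]
    positivity
  · have hN := latticeForm_pos z h
    rw [one_mul, neg_mul]
    refine (Real.exp_neg_le_factorial_mul_inv_pow n (by positivity)).trans (le_of_eq ?_)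
    rw [Real.rpow_neg hN.le, Real.rpow_natCast, mul_assoc (n.factorial : ℝ), ← mul_inv, ← mul_pow,
      mul_right_comm]

lemma summable_thetaTerm (z : UpperHalfPlane) {t : ℝ} (ht : 0 < t) : Summable (thetaTerm z t) :=
  ((summable_latticeForm_rpow z (k := (2 : ℕ)) (by norm_num)).mul_left _).of_nonneg_of_le
    (thetaTerm_nonneg z t) (thetaTerm_le z ht 2)

/-- The theta series `∑ exp (-π t |m z + n|² / Im z)`. -/
noncomputable def latticeTheta (z : UpperHalfPlane) (t : ℝ) : ℝ :=
  1 + ∑' v, thetaTerm z t v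

lemma hasSum_latticeTheta (z : UpperHalfPlane) {t : ℝ} (ht : 0 < t) :
    HasSum (fun v => Real.exp (-(Real.pi * latticeForm z v) * t)) (latticeTheta z t) := by
  have h := (hasSum_ite_eq (0 : ℤ × ℤ) (1 : ℝ)).add (summable_thetaTerm z ht).hasSum
  have h2 : ∀ v, Real.exp (-(Real.pi * latticeForm z v) * t) =
      (if v = 0 then 1 else 0) + thetaTerm z t v := by
    intro v
    rw [thetaTerm]
    split_ifs with hv
    · simp [hv, latticeForm_zero]
    · simp
  simp_rw [h2]
  exact h

/-- Each exponential is bounded by a power `(t N) ^ (-n)` of the form `N`, and `n` is free. -/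
lemma latticeTheta_sub_one_isBigO (z : UpperHalfPlane) (r : ℝ) :
    (fun t => ((latticeTheta z t : ℝ) : ℂ) - 1) =O[atTop] (fun t : ℝ => t ^ r) := by
  obtain ⟨n, hn⟩ := exists_nat_ge (max 2 (-r))
  have hn2 : (1 : ℝ) < n := by linarith [le_max_left 2 (-r)]
  have hnr : -(n : ℝ) ≤ r := by linarith [le_max_right 2 (-r)]
  have hs := summable_latticeForm_rpow z hn2
  refine IsBigO.of_bound (n.factorial * (Real.pi ^ n)⁻¹ *
    ∑' v, latticeForm z v ^ (-(n : ℝ))) ?_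
  filter_upwards [eventually_ge_atTop 1] with t ht
  have ht0 : 0 < t := by linarith
  have h1 : ((latticeTheta z t : ℝ) : ℂ) - 1 = ((∑' v, thetaTerm z t v : ℝ) : ℂ) := by
    rw [latticeTheta]
    push_cast
    ring
  rw [h1, Complex.norm_real, Real.norm_of_nonneg (tsum_nonneg (thetaTerm_nonneg z t)),
    Real.norm_of_nonneg (Real.rpow_nonneg ht0.le _)]
  have h2 := (summable_thetaTerm z ht0).tsum_le_tsum (thetaTerm_le z ht0 n) (hs.mul_left _)
  rw [tsum_mul_left] at h2
  refine h2.trans ?_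
  have h3 : t ^ (-(n : ℝ)) ≤ t ^ r := Real.rpow_le_rpow_of_exponent_le ht hnr
  rw [Real.rpow_neg ht0.le, Real.rpow_natCast] at h3
  have h4 : 0 ≤ n.factorial * (Real.pi ^ n)⁻¹ * ∑' v, latticeForm z v ^ (-(n : ℝ)) :=
    mul_nonneg (by positivity) (tsum_nonneg fun v => Real.rpow_nonneg (latticeForm_nonneg z v) _)
  calc _ = n.factorial * (Real.pi ^ n)⁻¹ * (∑' v, latticeForm z v ^ (-(n : ℝ))) * (t ^ n)⁻¹ := by
        rw [mul_pow, mul_inv]; ring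
    _ ≤ _ := mul_le_mul_of_nonneg_left h3 h4

lemma continuousOn_latticeTheta (z : UpperHalfPlane) :
    ContinuousOn (latticeTheta z) (Set.Ioi 0) := by
  intro t ht
  have ht : 0 < t := ht
  -- On `[t / 2, ∞)` the terms are dominated by their values at `t / 2`.
  have h : ContinuousOn (latticeTheta z) (Set.Ici (t / 2)) := by
    refine continuousOn_const.add (continuousOn_tsum (u := thetaTerm z (t / 2)) ?_
      (summable_thetaTerm z (by positivity)) ?_)
    · intro v
      unfold thetaTerm
      fun_prop
    · intro v s hs
      rw [Real.norm_of_nonneg (thetaTerm_nonneg z s v)]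
      unfold thetaTerm
      refine mul_le_mul_of_nonneg_left (Real.exp_le_exp.mpr ?_) (by split_ifs <;> norm_num)
      have := latticeForm_nonneg z v
      rw [neg_mul, neg_mul, neg_le_neg_iff]
      exact mul_le_mul_of_nonneg_left hs (by positivity)
  exact (h.continuousAt (Ici_mem_nhds (by linarith))).continuousWithinAt

/-- The summands of the theta series after Poisson summation in one of the variables. -/
noncomputable def dualThetaTerm (z : UpperHalfPlane) (t : ℝ) (v : ℤ × ℤ) : ℂ :=
  Complex.exp (-Real.pi * t * z.im * v.1 ^ 2) *
    Complex.exp (-Real.pi * (z.im / t) * v.2 ^ 2 - 2 * Real.pi * Complex.I * z.re * v.1 * v.2)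

/-- The phase has modulus one, so the absolute values are products of two one-dimensional Gaussians.
-/
lemma summable_dualThetaTerm (z : UpperHalfPlane) {t : ℝ} (ht : 0 < t) :
    Summable (dualThetaTerm z t) := by
  have h : ∀ a : ℝ, 0 < a → Summable fun n : ℤ => Real.exp (-Real.pi * a * n ^ 2) := by
    intro a ha
    have h1 := ((summable_jacobiTheta₂_term_iff 0 (Complex.I * a)).mpr (by simpa using ha)).norm
    refine h1.congr fun n => ?_
    rw [norm_jacobiTheta₂_term]
    congr 1
    simp
    ring
  have hy := z.im_pos
  have := (h (t * z.im) (by positivity)).mul_of_nonneg (h (z.im / t) (by positivity))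
    (fun _ => (Real.exp_pos _).le) (fun _ => (Real.exp_pos _).le)
  refine Summable.of_norm (this.congr fun v => ?_)
  rw [dualThetaTerm, norm_mul, Complex.norm_exp, Complex.norm_exp]
  congr 2
  · have : -(Real.pi : ℂ) * t * z.im * v.1 ^ 2 = ((-Real.pi * (t * z.im) * v.1 ^ 2 : ℝ) : ℂ) := by
      push_cast; ring
    rw [this, Complex.ofReal_re]
  · have : -(Real.pi : ℂ) * (z.im / t) * v.2 ^ 2 - 2 * Real.pi * Complex.I * z.re * v.1 * v.2 =
        ((-Real.pi * (z.im / t) * v.2 ^ 2 : ℝ) : ℂ) +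
          ((-2 * Real.pi * z.re * v.1 * v.2 : ℝ) : ℂ) * Complex.I := by
      push_cast; ring
    rw [this, Complex.add_re, Complex.ofReal_re, Complex.re_ofReal_mul]
    simp

/-- Poisson summation in `n` for each fixed `m`: the shift of the Gaussian by `m x` becomes a phase.
-/
lemma latticeTheta_eq_dual (z : UpperHalfPlane) {t : ℝ} (ht : 0 < t) :
    ((latticeTheta z t : ℝ) : ℂ) = (√(z.im / t) : ℝ) * ∑' v, dualThetaTerm z t v := by
  have hy := z.im_pos
  have hs := (hasSum_latticeTheta z ht)
  rw [← hs.tsum_eq, hs.summable.tsum_prod, (summable_dualThetaTerm z ht).tsum_prod,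
    Complex.ofReal_tsum, ← tsum_mul_left]
  refine tsum_congr fun m => ?_
  have ha : 0 < ((z.im / t : ℝ) : ℂ).re := by
    rw [Complex.ofReal_re]; positivity
  have hP := Complex.tsum_exp_neg_quadratic ha (-Complex.I * m * z.re)
  have hr : ((z.im / t : ℝ) : ℂ) ^ (1 / 2 : ℂ) = ((√(z.im / t) : ℝ) : ℂ) := by
    rw [Real.sqrt_eq_rpow, Complex.ofReal_cpow (by positivity)]
    norm_num
  have hr0 : ((√(z.im / t) : ℝ) : ℂ) ≠ 0 := by
    rw [ne_eq, Complex.ofReal_eq_zero]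
    positivity
  rw [hr, one_div, eq_inv_mul_iff_mul_eq₀ hr0] at hP
  unfold dualThetaTerm
  simp only
  rw [tsum_mul_left, mul_left_comm]
  have e1 : ∀ n : ℤ, -(Real.pi : ℂ) * ((z.im / t : ℝ) : ℂ) * n ^ 2 +
      2 * Real.pi * (-Complex.I * m * z.re) * n = -(Real.pi : ℂ) * (z.im / t) * n ^ 2 -
        2 * Real.pi * Complex.I * z.re * m * n := by
    intro n; push_cast; ring
  simp_rw [e1] at hP
  rw [hP, ← tsum_mul_left, Complex.ofReal_tsum]
  refine tsum_congr fun n => ?_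
  have hy' : (z.im : ℂ) ≠ 0 := Complex.ofReal_ne_zero.mpr hy.ne'
  have ht' : (t : ℂ) ≠ 0 := Complex.ofReal_ne_zero.mpr ht.ne'
  rw [latticeForm_eq, Complex.ofReal_exp, ← Complex.exp_add]
  congr 1
  push_cast
  field_simp
  linear_combination ((m * z.re : ℂ) ^ 2 * (Complex.I ^ 2 - 1) - 2 * n * m * z.re) * Complex.I_sq
 
/-- After Poisson summation in one variable, `t ↦ 1 / t` amounts to exchanging `m` and `n`; only the
square root in front changes, by the factor `t`. -/
lemma latticeTheta_one_div (z : UpperHalfPlane) {t : ℝ} (ht : 0 < t) :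
    latticeTheta z (1 / t) = t * latticeTheta z t := by
  have hy := z.im_pos
  have h1 : ∑' v, dualThetaTerm z (1 / t) v = ∑' v, dualThetaTerm z t v := by
    rw [← (Equiv.prodComm ℤ ℤ).tsum_eq]
    refine tsum_congr fun v => ?_
    simp only [dualThetaTerm, Equiv.prodComm_apply, Prod.fst_swap, Prod.snd_swap]
    rw [← Complex.exp_add, ← Complex.exp_add]
    congr 1
    push_cast
    rw [div_div_eq_mul_div, div_one]
    ring
  have h2 : √(z.im / (1 / t)) = t * √(z.im / t) := by
    have h : z.im / (1 / t) = t ^ 2 * (z.im / t) := by field_simp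
    rw [h, Real.sqrt_mul (sq_nonneg t), Real.sqrt_sq ht.le]
  have h3 := latticeTheta_eq_dual z (one_div_pos.mpr ht)
  rw [h1, h2, Complex.ofReal_mul, mul_assoc, ← latticeTheta_eq_dual z ht] at h3
  exact_mod_cast h3

/-- The functional equation of the theta series, as a `WeakFEPair`. -/
noncomputable def latticeThetaFEPair (z : UpperHalfPlane) : WeakFEPair ℂ where
  f t := (latticeTheta z t : ℂ)
  g t := (latticeTheta z t : ℂ)
  k := 1
  ε := 1
  f₀ := 1
  g₀ := 1
  hf_int := ((Complex.continuous_ofReal.comp_continuousOn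
    (continuousOn_latticeTheta z)).locallyIntegrableOn measurableSet_Ioi)
  hg_int := ((Complex.continuous_ofReal.comp_continuousOn
    (continuousOn_latticeTheta z)).locallyIntegrableOn measurableSet_Ioi)
  hk := one_pos
  hε := one_ne_zero
  h_feq x hx := by simp [latticeTheta_one_div z hx, -one_div]
  hf_top := latticeTheta_sub_one_isBigO z
  hg_top := latticeTheta_sub_one_isBigO z

/-! ### The Epstein zeta function and its continuation -/

/-- The Epstein zeta function `∑ (Im z / |m z + n|²) ^ s`, continued to the complex plane. -/
noncomputable def epsteinZeta (z : UpperHalfPlane) (s : ℂ) : ℂ :=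
  (Real.pi : ℂ) ^ s * (Complex.Gamma s)⁻¹ * (latticeThetaFEPair z).Λ s

/-- The Mellin transform of the theta series minus `1`, taken term by term. The zero vector does no
harm, because its summand is `0⁻¹ ^ s = 0 ^ s = 0`. -/
lemma hasSum_epsteinZeta (z : UpperHalfPlane) {s : ℂ} (hs : 1 < s.re) :
    HasSum (fun v => (((latticeForm z v)⁻¹ : ℝ) : ℂ) ^ s) (epsteinZeta z s) := by
  have hs0 : 0 < s.re := by linarith
  have hs1 : s ≠ 0 := fun h => by simp [h] at hs0
  have hM := ((latticeThetaFEPair z).hasMellin (s := s) hs).2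
  have hS := hasSum_mellin_pi_mul (ι := ℤ × ℤ) (a := fun v => if v = 0 then 0 else 1)
    (q := latticeForm z) (F := fun t => (latticeTheta z t : ℂ) - 1) (s := s)
    (fun v => by
      by_cases hv : v = 0
      · simp [hv]
      · exact Or.inr (latticeForm_pos z hv)) hs0 (fun t ht => by
      have h := Complex.hasSum_ofReal.mpr (summable_thetaTerm z ht).hasSum
      have e : (latticeTheta z t : ℂ) - 1 = ((∑' v, thetaTerm z t v : ℝ) : ℂ) := by
        rw [latticeTheta]
        push_cast
        ring
      simp only [e]
      refine h.congr_fun fun v => ?_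
      rw [thetaTerm]
      split_ifs <;> simp) (by
      refine (summable_latticeForm_rpow z hs).of_nonneg_of_le
        (fun v => div_nonneg (norm_nonneg _) (Real.rpow_nonneg (latticeForm_nonneg z v) _))
        (fun v => ?_)
      rw [Real.rpow_neg (latticeForm_nonneg z v), ← one_div]
      refine div_le_div_of_nonneg_right ?_ (Real.rpow_nonneg (latticeForm_nonneg z v) _)
      split_ifs <;> simp)
  have hM' : mellin (fun t => (latticeTheta z t : ℂ) - 1) s = (latticeThetaFEPair z).Λ s := hM
  rw [hM'] at hS
  have hG := Complex.Gamma_ne_zero_of_re_pos hs0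
  have hpi : (Real.pi : ℂ) ≠ 0 := Complex.ofReal_ne_zero.mpr Real.pi_ne_zero
  have hS2 := hS.mul_left ((Real.pi : ℂ) ^ s * (Complex.Gamma s)⁻¹)
  have key : ∀ v, (((latticeForm z v)⁻¹ : ℝ) : ℂ) ^ s = (Real.pi : ℂ) ^ s * (Complex.Gamma s)⁻¹ *
      ((Real.pi : ℂ) ^ (-s) * Complex.Gamma s * (if v = 0 then 0 else 1) / latticeForm z v ^ s) := by
    intro v
    split_ifs with hv
    · simp [hv, latticeForm_zero, Complex.zero_cpow hs1]
    · have hpos := latticeForm_pos z hv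
      rw [Complex.ofReal_inv, Complex.inv_cpow, Complex.cpow_neg]
      · have := (Complex.cpow_ne_zero_iff (y := s)).mpr (Or.inl hpi)
        field_simp
      · rw [Complex.arg_ofReal_of_nonneg hpos.le]
        exact Real.pi_pos.ne
  simp_rw [key]
  exact hS2

lemma epsteinZeta_eq (z : UpperHalfPlane) (s : ℂ) :
    epsteinZeta z s = (Real.pi : ℂ) ^ s * (Complex.Gamma s)⁻¹ *
      ((latticeThetaFEPair z).Λ₀ s - 1 / s - 1 / (1 - s)) := by
  simp [epsteinZeta, WeakFEPair.Λ, latticeThetaFEPair]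

lemma differentiable_pi_cpow_mul_Gamma_inv :
    Differentiable ℂ fun s : ℂ => (Real.pi : ℂ) ^ s * (Complex.Gamma s)⁻¹ := by
  have hpi : (Real.pi : ℂ) ≠ 0 := Complex.ofReal_ne_zero.mpr Real.pi_ne_zero
  exact (differentiable_id.const_cpow (Or.inl hpi)).mul Complex.differentiable_one_div_Gamma

lemma meromorphic_epsteinZeta (z : UpperHalfPlane) (s : ℂ) : MeromorphicAt (epsteinZeta z) s := by
  have h1 := ((latticeThetaFEPair z).differentiable_Λ₀.analyticAt s).meromorphicAt
  have h2 := (differentiable_pi_cpow_mul_Gamma_inv.analyticAt s).meromorphicAt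
  have h3 : epsteinZeta z = _ := funext (epsteinZeta_eq z)
  rw [h3]
  have hid : MeromorphicAt (fun s : ℂ => s) s := MeromorphicAt.id s
  have hc : MeromorphicAt (fun _ : ℂ => (1 : ℂ)) s := MeromorphicAt.const 1 s
  exact h2.mul ((h1.sub (hc.div hid)).sub (hc.div (hc.sub hid)))

/-- With `h s = π ^ s / Γ(s)`, the singular part at `1` is `h s / (s - 1)`. Since `h 1 = π`,
subtracting `π / (s - 1)` leaves a difference quotient of `h`. Only the existence of the limit
matters here. -/
lemma exists_tendsto_epsteinZeta_sub (z : UpperHalfPlane) :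
    ∃ K : ℂ, Tendsto (fun s => epsteinZeta z s - Real.pi / (s - 1)) (𝓝[≠] 1) (𝓝 K) := by
  set h : ℂ → ℂ := fun s => (Real.pi : ℂ) ^ s * (Complex.Gamma s)⁻¹ with hh
  have h1 : h 1 = Real.pi := by simp [hh]
  have hd := (differentiable_pi_cpow_mul_Gamma_inv 1).hasDerivAt.tendsto_slope
  have hL : Tendsto (fun s : ℂ => h s * ((latticeThetaFEPair z).Λ₀ s - 1 / s)) (𝓝[≠] 1)
      (𝓝 (h 1 * ((latticeThetaFEPair z).Λ₀ 1 - 1 / 1))) := by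
    apply tendsto_nhdsWithin_of_tendsto_nhds
    refine ContinuousAt.tendsto ?_
    refine (differentiable_pi_cpow_mul_Gamma_inv 1).continuousAt.mul
      (((latticeThetaFEPair z).differentiable_Λ₀ 1).continuousAt.sub ?_)
    exact continuousAt_const.div continuousAt_id one_ne_zero
  refine ⟨_, (hL.add hd).congr' ?_⟩
  filter_upwards [self_mem_nhdsWithin] with s hs
  have hs1 : s - 1 ≠ 0 := sub_ne_zero.mpr hs
  rw [epsteinZeta_eq, slope_def_field]
  change h s * _ + (h s - h 1) / (s - 1) = h s * _ - _
  rw [h1, ← neg_sub s 1]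
  field_simp
  ring

/-! ### Comparison of row sums with integrals -/

/-- Comparison of a sum over a translate of `ℤ` with an integral, in terms of the derivative. -/
lemma summable_and_abs_tsum_sub_integral_le {f f' : ℝ → ℝ} (hd : ∀ u, HasDerivAt f (f' u) u)
    (hf : Integrable f) (hf' : Integrable f') (a : ℝ) :
    Summable (fun n : ℤ => f (a + n)) ∧
      |∑' n : ℤ, f (a + n) - ∫ u, f u| ≤ ∫ u, |f' u| := by
  have h1 := hf.hasSum_intervalIntegral a
  have h2 := hf'.abs.hasSum_intervalIntegral a
  -- On a unit interval `f (a + n) - f u` is an integral of `f'`, hence bounded by the integral of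
  -- `|f'|` over that interval; these bounds add up to `∫ |f'|`.
  have key : ∀ n : ℤ, ‖f (a + n) - ∫ u in (a + n)..(a + n + 1), f u‖ ≤
      ∫ u in (a + n)..(a + n + 1), |f' u| := by
    intro n
    have hle : a + n ≤ a + n + 1 := by linarith
    have e : f (a + n) - ∫ u in (a + n)..(a + n + 1), f u =
        ∫ u in (a + n)..(a + n + 1), (f (a + n) - f u) := by
      rw [intervalIntegral.integral_sub intervalIntegrable_const hf.intervalIntegrable]
      simp
    rw [e]
    have hb : ∀ u ∈ Set.uIoc (a + n) (a + n + 1), ‖f (a + n) - f u‖ ≤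
        ∫ v in (a + n)..(a + n + 1), |f' v| := by
      intro u hu
      rw [Set.uIoc_of_le hle] at hu
      have hF : ∫ v in (a + n)..u, f' v = f u - f (a + n) :=
        intervalIntegral.integral_eq_sub_of_hasDerivAt (fun v _ => hd v) hf'.intervalIntegrable
      rw [norm_sub_rev, ← hF]
      refine (intervalIntegral.norm_integral_le_integral_norm hu.1.le).trans ?_
      exact intervalIntegral.integral_mono_interval le_rfl hu.1.le hu.2
        (Eventually.of_forall fun v => abs_nonneg _) hf'.abs.intervalIntegrable
    have := intervalIntegral.norm_integral_le_of_norm_le_const hb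
    simpa using this
  have h3 : Summable fun n : ℤ => f (a + n) - ∫ u in (a + n)..(a + n + 1), f u :=
    Summable.of_norm_bounded h2.summable key
  have h4 : Summable fun n : ℤ => f (a + n) := by
    simpa using h3.add h1.summable
  refine ⟨h4, ?_⟩
  rw [← h1.tsum_eq, ← h4.tsum_sub h1.summable]
  exact tsum_of_norm_bounded h2 key

lemma integrable_one_add_sq_rpow_neg {s : ℝ} (hs : 1 / 2 < s) :
    Integrable fun u : ℝ => (1 + u ^ 2) ^ (-s) := by
  have := integrable_rpow_neg_one_add_norm_sq (E := ℝ) (μ := volume) (r := 2 * s)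
    (by simp; linarith)
  refine this.congr (Eventually.of_forall fun u => ?_)
  simp only [Real.norm_eq_abs, sq_abs]
  congr 1
  ring

/-- Write `(1 + u²) ^ (-s) Γ(s)` as a Gamma integral in `t` and exchange the integrals: the inner
one becomes Gaussian in `u`. With lower integrals of nonnegative functions the exchange is Tonelli's
theorem. -/
lemma integral_one_add_sq_rpow_neg {s : ℝ} (hs : 1 / 2 < s) :
    ∫ u : ℝ, (1 + u ^ 2) ^ (-s) = √Real.pi * Real.Gamma (s - 1 / 2) / Real.Gamma s := by
  have hG : 0 < Real.Gamma s := Real.Gamma_pos_of_pos (by linarith)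
  rw [eq_div_iff hG.ne']
  have hI1 : ∀ u : ℝ, ∫⁻ t in Set.Ioi (0 : ℝ),
      ENNReal.ofReal (t ^ (s - 1) * Real.exp (-((1 + u ^ 2) * t))) =
        ENNReal.ofReal ((1 + u ^ 2) ^ (-s) * Real.Gamma s) := by
    intro u
    have hu : 0 < 1 + u ^ 2 := by positivity
    rw [← ofReal_integral_eq_lintegral_ofReal]
    · rw [Real.integral_rpow_mul_exp_neg_mul_Ioi (by linarith) hu, Real.rpow_neg hu.le, one_div,
        Real.inv_rpow hu.le]
    · have := integrableOn_rpow_mul_exp_neg_mul_rpow (p := 1) (s := s - 1) (b := 1 + u ^ 2)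
        (by linarith) one_pos hu
      simp only [Real.rpow_one, neg_mul] at this
      exact this
    · filter_upwards [ae_restrict_mem measurableSet_Ioi] with t ht
      have := Real.rpow_nonneg (le_of_lt (show (0 : ℝ) < t from ht)) (s - 1)
      positivity
  have hI2 : ∀ t ∈ Set.Ioi (0 : ℝ), ∫⁻ u : ℝ,
      ENNReal.ofReal (t ^ (s - 1) * Real.exp (-((1 + u ^ 2) * t))) =
        ENNReal.ofReal (√Real.pi * (Real.exp (-t) * t ^ (s - 1 / 2 - 1))) := by
    intro t ht
    have ht : 0 < t := ht
    have e : ∀ u : ℝ, t ^ (s - 1) * Real.exp (-((1 + u ^ 2) * t)) =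
        (t ^ (s - 1) * Real.exp (-t)) * Real.exp (-t * u ^ 2) := by
      intro u
      rw [mul_assoc, ← Real.exp_add]
      congr 2
      ring
    simp_rw [e]
    rw [← ofReal_integral_eq_lintegral_ofReal ((integrable_exp_neg_mul_sq ht).const_mul _)
      (Eventually.of_forall fun u => by positivity), integral_const_mul, integral_gaussian,
      Real.sqrt_div Real.pi_pos.le, show s - 1 / 2 - 1 = (s - 1) - 1 / 2 by ring,
      Real.rpow_sub ht (s - 1) (1 / 2), Real.sqrt_eq_rpow t]
    congr 1
    ring
  have hswap : ∫⁻ u : ℝ, ∫⁻ t in Set.Ioi (0 : ℝ),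
      ENNReal.ofReal (t ^ (s - 1) * Real.exp (-((1 + u ^ 2) * t))) =
      ∫⁻ t in Set.Ioi (0 : ℝ), ∫⁻ u : ℝ,
      ENNReal.ofReal (t ^ (s - 1) * Real.exp (-((1 + u ^ 2) * t))) := by
    apply lintegral_lintegral_swap
    refine Measurable.aemeasurable ?_
    fun_prop
  simp_rw [hI1] at hswap
  rw [setLIntegral_congr_fun measurableSet_Ioi hI2] at hswap
  have hR := (Real.GammaIntegral_convergent (s := s - 1 / 2) (by linarith)).const_mul (√Real.pi)
  have hL := (integrable_one_add_sq_rpow_neg hs).mul_const (Real.Gamma s)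
  rw [← ofReal_integral_eq_lintegral_ofReal hL
      (Eventually.of_forall fun u => by positivity),
    ← ofReal_integral_eq_lintegral_ofReal hR] at hswap
  · rw [ENNReal.ofReal_eq_ofReal_iff, integral_mul_const, integral_const_mul] at hswap
    · rw [hswap, Real.Gamma_eq_integral (by linarith)]
    · exact integral_nonneg fun u => by positivity
    · refine setIntegral_nonneg measurableSet_Ioi fun t ht => ?_
      have := Real.rpow_nonneg (le_of_lt (show (0 : ℝ) < t from ht)) (s - 1 / 2 - 1)
      positivity
  · filter_upwards [ae_restrict_mem measurableSet_Ioi] with t ht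
    have := Real.rpow_nonneg (le_of_lt (show (0 : ℝ) < t from ht)) (s - 1 / 2 - 1)
    positivity

section shifted

variable {b : ℝ}

lemma sq_add_sq_rpow_neg_eq (hb : 0 < b) (s u : ℝ) :
    (u ^ 2 + b ^ 2) ^ (-s) = b ^ (-(2 * s)) * (1 + (u * b⁻¹) ^ 2) ^ (-s) := by
  have h : u ^ 2 + b ^ 2 = b ^ 2 * (1 + (u * b⁻¹) ^ 2) := by field_simp; ring
  rw [h, Real.mul_rpow (by positivity) (by positivity), ← Real.rpow_natCast, ← Real.rpow_mul hb.le]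
  congr 2
  push_cast
  ring

lemma integrable_sq_add_sq_rpow_neg (hb : 0 < b) {s : ℝ} (hs : 1 / 2 < s) :
    Integrable fun u : ℝ => (u ^ 2 + b ^ 2) ^ (-s) := by
  simp_rw [sq_add_sq_rpow_neg_eq hb s]
  exact ((integrable_one_add_sq_rpow_neg hs).comp_mul_right' (inv_ne_zero hb.ne')).const_mul _

lemma integral_sq_add_sq_rpow_neg (hb : 0 < b) (s : ℝ) :
    ∫ u : ℝ, (u ^ 2 + b ^ 2) ^ (-s) = b ^ (1 - 2 * s) * ∫ u : ℝ, (1 + u ^ 2) ^ (-s) := by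
  simp_rw [sq_add_sq_rpow_neg_eq hb s]
  rw [integral_const_mul, Measure.integral_comp_mul_right (fun u : ℝ => (1 + u ^ 2) ^ (-s)),
    inv_inv, abs_of_pos hb, smul_eq_mul, ← mul_assoc, sub_eq_add_neg, add_comm,
    Real.rpow_add_one hb.ne']

lemma hasDerivAt_sq_add_sq_rpow_neg (hb : 0 < b) (s u : ℝ) :
    HasDerivAt (fun u : ℝ => (u ^ 2 + b ^ 2) ^ (-s)) (-(2 * s * u * (u ^ 2 + b ^ 2) ^ (-s - 1))) u := by
  have h1 : HasDerivAt (fun u : ℝ => u ^ 2 + b ^ 2) (2 * u) u := by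
    simpa using (hasDerivAt_pow 2 u).add_const (b ^ 2)
  convert! h1.rpow_const (p := -s) (Or.inl (by positivity)) using 1
  ring

/-- From `2 b |u| ≤ u² + b²` and `u² + b² ≥ b²`. The power is lowered to `-1`, where the integral is
`π / b`, so that the error of a row is at most `s π b ^ (-2s)`. -/
lemma abs_deriv_sq_add_sq_rpow_neg_le (hb : 0 < b) {s : ℝ} (hs : 1 ≤ s) (u : ℝ) :
    |-(2 * s * u * (u ^ 2 + b ^ 2) ^ (-s - 1))| ≤ s * b ^ (1 - 2 * s) * (u ^ 2 + b ^ 2) ^ (-1 : ℝ) := by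
  have hQ : 0 < u ^ 2 + b ^ 2 := by positivity
  have hs0 : 0 < s := by linarith
  rw [abs_neg, abs_mul, abs_mul, abs_of_pos (show 0 < 2 * s by positivity),
    abs_of_pos (Real.rpow_pos_of_pos hQ _), show -s - 1 = (-1 : ℝ) + -1 + (1 - s) by ring,
    Real.rpow_add hQ, Real.rpow_add hQ]
  have h1 : |u| * (u ^ 2 + b ^ 2) ^ (-1 : ℝ) ≤ (2 * b)⁻¹ := by
    rw [Real.rpow_neg_one, ← div_eq_mul_inv, div_le_iff₀ hQ, inv_mul_eq_div, le_div_iff₀ (by positivity)]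
    nlinarith [sq_nonneg (|u| - b), sq_abs u]
  have h2 : (u ^ 2 + b ^ 2) ^ (1 - s) ≤ b ^ (2 - 2 * s) := by
    have : b ^ (2 - 2 * s) = (b ^ 2) ^ (1 - s) := by
      rw [← Real.rpow_natCast, ← Real.rpow_mul hb.le]
      congr 1
      push_cast
      ring
    rw [this]
    exact Real.rpow_le_rpow_of_nonpos (by positivity) (by nlinarith) (by linarith)
  have h3 : b ^ (2 - 2 * s) = b ^ (1 - 2 * s) * b := by
    rw [← Real.rpow_add_one hb.ne']
    congr 1
    ring
  have hm : 0 ≤ (u ^ 2 + b ^ 2) ^ (-1 : ℝ) := Real.rpow_nonneg hQ.le _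
  calc 2 * s * |u| * ((u ^ 2 + b ^ 2) ^ (-1 : ℝ) * (u ^ 2 + b ^ 2) ^ (-1 : ℝ) *
        (u ^ 2 + b ^ 2) ^ (1 - s))
      = 2 * s * (u ^ 2 + b ^ 2) ^ (-1 : ℝ) * ((|u| * (u ^ 2 + b ^ 2) ^ (-1 : ℝ)) *
        (u ^ 2 + b ^ 2) ^ (1 - s)) := by ring
    _ ≤ 2 * s * (u ^ 2 + b ^ 2) ^ (-1 : ℝ) * ((2 * b)⁻¹ * b ^ (2 - 2 * s)) := by
        refine mul_le_mul_of_nonneg_left ?_ (by positivity)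
        exact mul_le_mul h1 h2 (Real.rpow_nonneg hQ.le _) (by positivity)
    _ = _ := by
        rw [h3]
        field_simp

lemma integrable_deriv_sq_add_sq_rpow_neg (hb : 0 < b) {s : ℝ} (hs : 1 ≤ s) :
    Integrable fun u : ℝ => -(2 * s * u * (u ^ 2 + b ^ 2) ^ (-s - 1)) := by
  refine Integrable.mono' ((integrable_sq_add_sq_rpow_neg hb (s := 1) (by norm_num)).const_mul
    (s * b ^ (1 - 2 * s))) ?_ (Eventually.of_forall (abs_deriv_sq_add_sq_rpow_neg_le hb hs))
  refine Measurable.aestronglyMeasurable ?_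
  fun_prop

lemma integral_one_add_sq_rpow_neg_one : ∫ u : ℝ, (1 + u ^ 2) ^ (-1 : ℝ) = Real.pi := by
  simp_rw [Real.rpow_neg_one]
  exact integral_univ_inv_one_add_sq

lemma integral_abs_deriv_sq_add_sq_rpow_neg_le (hb : 0 < b) {s : ℝ} (hs : 1 ≤ s) :
    ∫ u : ℝ, |-(2 * s * u * (u ^ 2 + b ^ 2) ^ (-s - 1))| ≤ s * Real.pi * b ^ (-(2 * s)) := by
  have h := integral_mono (integrable_deriv_sq_add_sq_rpow_neg hb hs).abs
    ((integrable_sq_add_sq_rpow_neg hb (s := 1) (by norm_num)).const_mul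
    (s * b ^ (1 - 2 * s))) (abs_deriv_sq_add_sq_rpow_neg_le hb hs)
  refine h.trans (le_of_eq ?_)
  rw [integral_const_mul, integral_sq_add_sq_rpow_neg hb, integral_one_add_sq_rpow_neg_one]
  have h3 : b ^ (1 - 2 * s) = b ^ (-(2 * s)) * b := by
    rw [← Real.rpow_add_one hb.ne']
    congr 1
    ring
  have h4 : b ^ (1 - 2 * (1 : ℝ)) = b⁻¹ := by
    rw [← Real.rpow_neg_one]
    norm_num
  rw [h3, h4]
  field_simp

lemma summable_shifted_sq_add_sq_rpow_neg (hb : 0 < b) {s : ℝ} (hs : 1 ≤ s) (a : ℝ) :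
    Summable fun n : ℤ => ((a + n) ^ 2 + b ^ 2) ^ (-s) :=
  (summable_and_abs_tsum_sub_integral_le (hasDerivAt_sq_add_sq_rpow_neg hb s)
    (integrable_sq_add_sq_rpow_neg hb (by linarith))
    (integrable_deriv_sq_add_sq_rpow_neg hb hs) a).1

lemma abs_tsum_shifted_sub_le (hb : 0 < b) {s : ℝ} (hs : 1 ≤ s) (a : ℝ) :
    |∑' n : ℤ, ((a + n) ^ 2 + b ^ 2) ^ (-s) - b ^ (1 - 2 * s) * ∫ u : ℝ, (1 + u ^ 2) ^ (-s)| ≤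
      s * Real.pi * b ^ (-(2 * s)) := by
  have h := (summable_and_abs_tsum_sub_integral_le (hasDerivAt_sq_add_sq_rpow_neg hb s)
    (integrable_sq_add_sq_rpow_neg hb (by linarith))
    (integrable_deriv_sq_add_sq_rpow_neg hb hs) a).2
  rw [integral_sq_add_sq_rpow_neg hb] at h
  exact h.trans (integral_abs_deriv_sq_add_sq_rpow_neg_le hb hs)

/-- A bound independent of `s`, used for dominated convergence as `s ↓ 1`. -/
lemma Real.rpow_neg_le_add_of_mem_Icc {x s : ℝ} (hx : 0 < x) (h1 : 1 ≤ s) (h2 : s ≤ 2) :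
    x ^ (-s) ≤ x ^ (-1 : ℝ) + x ^ (-2 : ℝ) := by
  rcases le_total 1 x with h | h
  · have := Real.rpow_le_rpow_of_exponent_le h (neg_le_neg h1)
    have := Real.rpow_nonneg hx.le (-2)
    linarith
  · have := Real.rpow_le_rpow_of_exponent_ge hx h (neg_le_neg h2)
    have := Real.rpow_nonneg hx.le (-1)
    linarith

lemma tendsto_tsum_shifted_sq_add_sq_rpow_neg (hb : 0 < b) (a : ℝ) :
    Tendsto (fun s : ℝ => ∑' n : ℤ, ((a + n) ^ 2 + b ^ 2) ^ (-s)) (𝓝[>] 1)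
      (𝓝 (∑' n : ℤ, ((a + n) ^ 2 + b ^ 2) ^ (-1 : ℝ))) := by
  refine tendsto_tsum_of_dominated_convergence
    ((summable_shifted_sq_add_sq_rpow_neg hb le_rfl a).add
      (summable_shifted_sq_add_sq_rpow_neg hb one_le_two a)) (fun n => ?_) ?_
  · have hQ : (a + n) ^ 2 + b ^ 2 ≠ 0 := by positivity
    have : ContinuousAt (fun s : ℝ => ((a + n) ^ 2 + b ^ 2) ^ (-s)) 1 :=
      (Real.continuousAt_const_rpow hQ).comp continuousAt_neg
    exact this.tendsto.mono_left nhdsWithin_le_nhds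
  · filter_upwards [Ioc_mem_nhdsGT (show (1 : ℝ) < 2 by norm_num)] with s hs n
    have hQ : 0 < (a + n) ^ 2 + b ^ 2 := by positivity
    rw [Real.norm_of_nonneg (Real.rpow_nonneg hQ.le _)]
    exact Real.rpow_neg_le_add_of_mem_Icc hQ hs.1.le hs.2

end shifted

/-! ### Expansions in `q`: the eta function and the cotangent -/

lemma summable_qParam_pow_mul_pow (z : UpperHalfPlane) :
    Summable fun v : ℕ × ℕ =>
      Function.Periodic.qParam 1 (z : ℂ) ^ ((v.1 + 1) * (v.2 + 1)) / ((v.2 : ℂ) + 1) := by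
  set q := Function.Periodic.qParam 1 (z : ℂ) with hq
  have hq1 : ‖q‖ < 1 := by simpa [hq] using UpperHalfPlane.norm_qParam_lt_one 1 z
  have hg := summable_geometric_of_lt_one (norm_nonneg q) hq1
  have h := hg.mul_of_nonneg hg (fun n => by positivity) (fun n => by positivity)
  refine Summable.of_norm_bounded h fun v => ?_
  rw [norm_div, norm_pow, ← pow_add]
  have h1 : 1 ≤ ‖(v.2 : ℂ) + 1‖ := by
    have : (v.2 : ℂ) + 1 = ((v.2 + 1 : ℕ) : ℂ) := by push_cast; rfl
    rw [this, Complex.norm_natCast]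
    simp
  refine (div_le_self (by positivity) h1).trans ?_
  exact pow_le_pow_of_le_one (norm_nonneg q) hq1.le (by nlinarith [v.1.zero_le, v.2.zero_le])

/-- Expand the logarithm of each factor of the eta product and exchange the two summations. The
order with `m` outside is the one in which the rows of the lattice produce these terms; `q ^ (1 /
24)` accounts for `-π y / 12`. -/
lemma log_norm_eta (z : UpperHalfPlane) :
    Real.log ‖ModularForm.eta (z : ℂ)‖ = -(Real.pi * z.im / 12) -
      ∑' m : ℕ, (∑' n : ℕ, Function.Periodic.qParam 1 (z : ℂ) ^ ((n + 1) * (m + 1))).re / (m + 1) := by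
  set q := Function.Periodic.qParam 1 (z : ℂ) with hq
  have hq1 : ‖q‖ < 1 := by simpa [hq] using UpperHalfPlane.norm_qParam_lt_one 1 z
  have hqn : ∀ n : ℕ, ‖q ^ (n + 1)‖ < 1 := fun n => by
    rw [norm_pow]
    exact pow_lt_one₀ (norm_nonneg q) hq1 (by simp)
  have hne : ∀ n : ℕ, 1 - ModularForm.eta_q n z ≠ 0 := fun n =>
    ModularForm.one_sub_eta_q_ne_zero n z.2
  have hsum : Summable fun n : ℕ => Complex.log (1 - ModularForm.eta_q n z) := by
    have := Complex.summable_log_one_add_of_summable (ModularForm.summable_eta_q z).of_norm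
    simpa [sub_eq_add_neg] using this
  have hexp := Complex.cexp_tsum_eq_tprod hne hsum
  have hS := summable_qParam_pow_mul_pow z
  have hlog : ∑' n : ℕ, Complex.log (1 - ModularForm.eta_q n z) =
      -∑' m : ℕ, (∑' n : ℕ, q ^ ((n + 1) * (m + 1))) / (m + 1) := by
    have h1 : ∀ n : ℕ, Complex.log (1 - ModularForm.eta_q n z) =
        -∑' m : ℕ, q ^ ((n + 1) * (m + 1)) / ((m : ℂ) + 1) := by
      intro n
      have := (Complex.hasSum_taylorSeries_neg_log' (hqn n)).tsum_eq
      simp_rw [← pow_mul] at this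
      rw [this, neg_neg]
    simp_rw [h1]
    have hcomm : ∑' n : ℕ, ∑' m : ℕ, q ^ ((n + 1) * (m + 1)) / ((m : ℂ) + 1) =
        ∑' m : ℕ, ∑' n : ℕ, q ^ ((n + 1) * (m + 1)) / ((m : ℂ) + 1) :=
      Summable.tsum_comm (f := fun m n : ℕ => q ^ ((n + 1) * (m + 1)) / ((m : ℂ) + 1)) hS.prod_symm
    rw [tsum_neg, hcomm]
    simp_rw [tsum_div_const]
  have hS2 : Summable fun m : ℕ => (∑' n : ℕ, q ^ ((n + 1) * (m + 1))) / ((m : ℂ) + 1) := by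
    simpa [tsum_div_const] using hS.prod_symm.prod
  rw [ModularForm.eta, norm_mul, ← hexp, Complex.norm_exp, Real.log_mul (by simp [Function.Periodic.qParam])
    (Real.exp_ne_zero _), Real.log_exp, hlog, Function.Periodic.norm_qParam, Real.log_exp, Complex.neg_re,
    Complex.re_tsum hS2]
  congr 1
  · simp
    ring
  · congr 1
    refine tsum_congr fun m => ?_
    have : (m : ℂ) + 1 = ((m + 1 : ℝ) : ℂ) := by push_cast; rfl
    rw [this, Complex.div_ofReal_re]

/-- The summand `y / ((x + n)² + y²)` is `-Im (1 / (w + n))`, so this is the imaginary part of the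
equality of the partial fraction expansion and the `q`-expansion of `π cot (π w)`. -/
lemma tsum_im_div_shifted (w : UpperHalfPlane) :
    w.im * ∑' n : ℤ, ((w.re + n) ^ 2 + w.im ^ 2) ^ (-1 : ℝ) =
      Real.pi + 2 * Real.pi * (∑' n : ℕ, Function.Periodic.qParam 1 (w : ℂ) ^ (n + 1)).re := by
  set q := Function.Periodic.qParam 1 (w : ℂ) with hq
  have hq1 : ‖q‖ < 1 := by simpa [hq] using UpperHalfPlane.norm_qParam_lt_one 1 w
  have hqe : q = Complex.exp (2 * Real.pi * Complex.I * w) := by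
    simp [hq, Function.Periodic.qParam]
  obtain ⟨f, hf⟩ : ∃ f : ℤ → ℝ, ∀ n, f n = w.im * ((w.re + n) ^ 2 + w.im ^ 2) ^ (-1 : ℝ) :=
    ⟨_, fun _ => rfl⟩
  have hS : Summable f := by
    rw [summable_congr hf]
    exact (summable_shifted_sq_add_sq_rpow_neg w.im_pos le_rfl w.re).mul_left w.im
  have him : ∀ n : ℤ, f n = -(1 / ((w : ℂ) + n)).im := by
    intro n
    rw [hf, one_div, Complex.inv_im, Real.rpow_neg_one, Complex.normSq_apply]
    simp
    ring
  have hz := UpperHalfPlane.coe_mem_integerComplement w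
  have hcot := cot_series_rep' hz
  have hcs : Summable fun n : ℕ => 1 / ((w : ℂ) - (n + 1)) + 1 / ((w : ℂ) + (n + 1)) :=
    summable_cotTerm hz
  have h1 := pi_mul_cot_pi_q_exp w
  rw [← hqe] at h1
  have hgeo : ∑' n : ℕ, q ^ n = 1 + ∑' n : ℕ, q ^ (n + 1) := by
    simpa using (summable_geometric_of_norm_lt_one hq1).tsum_eq_zero_add
  rw [hgeo] at h1
  rw [h1] at hcot
  have h2 := congrArg Complex.im hcot
  rw [Complex.im_tsum hcs] at h2
  rw [← tsum_mul_left, ← tsum_congr hf]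
  have hp : Summable fun n : ℕ => f (n + 1) :=
    hS.comp_injective (i := fun n : ℕ => (n + 1 : ℤ)) (fun a b h => by simpa using h)
  have hn : Summable fun n : ℕ => f (-(n + 1)) :=
    hS.comp_injective (i := fun n : ℕ => (-(n + 1) : ℤ)) (fun a b h => by simpa using h)
  rw [tsum_of_add_one_of_neg_add_one hp hn]
  have h4 := hp.tsum_add hn
  have h5 : ∀ n : ℕ, (1 / ((w : ℂ) - (n + 1)) + 1 / ((w : ℂ) + (n + 1))).im =
      -(f (n + 1) + f (-(n + 1))) := by
    intro n
    rw [him, him, Complex.add_im]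
    push_cast
    rw [← sub_eq_add_neg]
    ring_nf
  simp_rw [h5] at h2
  rw [tsum_neg, h4] at h2
  have h6 := him 0
  simp only [Int.cast_zero, add_zero] at h6
  have h7 : (Real.pi * Complex.I - 2 * Real.pi * Complex.I * (1 + ∑' n : ℕ, q ^ (n + 1)) -
      1 / (w : ℂ)).im = -Real.pi - 2 * Real.pi * (∑' n : ℕ, q ^ (n + 1)).re - (1 / (w : ℂ)).im := by
    simp only [Complex.sub_im, Complex.mul_im, Complex.add_re, Complex.mul_re]
    simp
    ring
  rw [h7] at h2
  linarith

/-! ### Zeta and Gamma factors at `s = 1` -/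

lemma tsum_nat_rpow_neg_eq_riemannZeta {s : ℝ} (hs : 1 < s) :
    ∑' n : ℕ, ((n : ℝ) + 1) ^ (-s) = (riemannZeta s).re := by
  rw [zeta_eq_tsum_one_div_nat_add_one_cpow (by simpa using hs)]
  have : ∀ n : ℕ, 1 / ((n : ℂ) + 1) ^ (s : ℂ) = (((n : ℝ) + 1) ^ (-s) : ℝ) := by
    intro n
    have hn : (0 : ℝ) ≤ (n : ℝ) + 1 := by positivity
    rw [Real.rpow_neg hn, Complex.ofReal_inv, Complex.ofReal_cpow hn]
    simp
  simp_rw [this]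
  rw [← Complex.ofReal_tsum, Complex.ofReal_re]

lemma summable_nat_add_one_rpow_neg {s : ℝ} (hs : 1 < s) :
    Summable fun n : ℕ => ((n : ℝ) + 1) ^ (-s) := by
  have := (summable_nat_add_iff 1).mpr (Real.summable_nat_rpow.mpr (neg_lt_neg hs))
  simpa using this

lemma tendsto_re_riemannZeta_two_mul :
    Tendsto (fun s : ℝ => (riemannZeta ((2 * s : ℝ) : ℂ)).re) (𝓝[>] 1) (𝓝 (Real.pi ^ 2 / 6)) := by
  have h1 : ContinuousAt (fun s : ℝ => (riemannZeta ((2 * s : ℝ) : ℂ)).re) 1 := by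
    refine Complex.continuous_re.continuousAt.comp ?_
    refine ContinuousAt.comp (g := riemannZeta) ?_ (by fun_prop)
    exact (differentiableAt_riemannZeta (by norm_num)).continuousAt
  have h2 := h1.tendsto.mono_left (nhdsWithin_le_nhds (s := Set.Ioi 1))
  have h3 : (riemannZeta ((2 * (1 : ℝ) : ℝ) : ℂ)).re = Real.pi ^ 2 / 6 := by
    have : (((2 * (1 : ℝ) : ℝ) : ℂ)) = 2 := by norm_num
    rw [this, riemannZeta_two]
    norm_cast
  rwa [h3] at h2

lemma tendsto_re_riemannZeta_two_mul_sub_one :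
    Tendsto (fun s : ℝ => (riemannZeta ((2 * s - 1 : ℝ) : ℂ)).re - 1 / (2 * (s - 1))) (𝓝[>] 1)
      (𝓝 Real.eulerMascheroniConstant) := by
  have h1 : Tendsto (fun s : ℝ => 2 * s - 1) (𝓝[>] 1) (𝓝[>] 1) := by
    refine tendsto_nhdsWithin_of_tendsto_nhds_of_eventually_within _ ?_ ?_
    · have : ContinuousAt (fun s : ℝ => 2 * s - 1) 1 := by fun_prop
      have h2 := this.tendsto.mono_left (nhdsWithin_le_nhds (s := Set.Ioi 1))
      norm_num at h2
      exact h2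
    · filter_upwards [self_mem_nhdsWithin] with s hs
      have : (1 : ℝ) < s := hs
      show (1 : ℝ) < 2 * s - 1
      linarith
  have h2 := (Complex.continuous_re.tendsto _).comp
    (ZetaAsymptotics.tendsto_riemannZeta_sub_one_div_nhds_right.comp h1)
  rw [Complex.ofReal_re] at h2
  refine h2.congr fun s => ?_
  simp only [Function.comp_apply, Complex.sub_re]
  congr 1
  have : (1 : ℂ) / (((2 * s - 1 : ℝ) : ℂ) - 1) = ((1 / (2 * (s - 1)) : ℝ) : ℂ) := by
    push_cast
    ring
  rw [this, Complex.ofReal_re]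

/-- Here `Γ'(1/2) = -√π (γ + 2 log 2)` and `Γ'(1) = -γ`, so Euler's constant cancels in the
derivative of the quotient. -/
lemma hasDerivAt_rpow_mul_Gamma_div_Gamma {y : ℝ} (hy : 0 < y) :
    HasDerivAt (fun s : ℝ => 2 * y ^ (1 - s) * (√Real.pi * Real.Gamma (s - 1 / 2) / Real.Gamma s))
      (-2 * Real.pi * Real.log y - 4 * Real.pi * Real.log 2) 1 := by
  have h1 : HasDerivAt (fun s : ℝ => y ^ (1 - s)) (-Real.log y) 1 := by
    have := ((hasDerivAt_id (1 : ℝ)).const_sub 1).const_rpow hy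
    simpa using this
  have h2 : HasDerivAt (fun s : ℝ => Real.Gamma (s - 1 / 2))
      (-√Real.pi * (Real.eulerMascheroniConstant + 2 * Real.log 2)) 1 := by
    have h := Real.hasDerivAt_Gamma_one_half
    have e : (1 / 2 : ℝ) = 1 - 1 / 2 := by norm_num
    rw [e] at h
    exact h.comp_sub_const 1 (1 / 2)
  have h3 := (h1.const_mul 2).mul (((h2.const_mul √Real.pi).div Real.hasDerivAt_Gamma_one
    (by simp)))
  convert! h3 using 1
  have e : (1 : ℝ) - 1 / 2 = 1 / 2 := by norm_num
  have hpi := Real.mul_self_sqrt Real.pi_pos.le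
  simp only [Pi.div_apply]
  rw [e, Real.Gamma_one_half_eq, Real.Gamma_one]
  simp only [sub_self, Real.rpow_zero]
  linear_combination (2 * Real.log y + 4 * Real.log 2) * hpi

/-- The expression is `G s * ζ(2s - 1)` with `G 1 = 2π`, and `ζ(2s - 1) = 1 / (2 (s - 1)) + γ +
o(1)`; the limit is `G 1 * γ + G' 1 / 2`. -/
lemma tendsto_two_mul_rpow_mul_integral_mul_zeta {y : ℝ} (hy : 0 < y) :
    Tendsto (fun s : ℝ => 2 * (y ^ (1 - s) * (∫ u : ℝ, (1 + u ^ 2) ^ (-s)) *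
        ∑' n : ℕ, ((n : ℝ) + 1) ^ (1 - 2 * s)) - Real.pi / (s - 1)) (𝓝[>] 1)
      (𝓝 (2 * Real.pi * Real.eulerMascheroniConstant - Real.pi * Real.log y -
        2 * Real.pi * Real.log 2)) := by
  have hd := hasDerivAt_rpow_mul_Gamma_div_Gamma hy
  set G : ℝ → ℝ := fun s => 2 * y ^ (1 - s) * (√Real.pi * Real.Gamma (s - 1 / 2) / Real.Gamma s)
    with hG
  have hG1 : G 1 = 2 * Real.pi := by
    have e : (1 : ℝ) - 1 / 2 = 1 / 2 := by norm_num
    simp only [hG]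
    rw [e, Real.Gamma_one_half_eq, Real.Gamma_one, Real.mul_self_sqrt Real.pi_pos.le]
    simp
  have hs := hd.tendsto_slope.mono_left (nhdsWithin_mono (1 : ℝ)
    (show Set.Ioi (1 : ℝ) ⊆ {1}ᶜ from fun x hx => (ne_of_gt hx)))
  have hc := hd.continuousAt.tendsto.mono_left (nhdsWithin_le_nhds (s := Set.Ioi 1))
  have h := (hc.mul tendsto_re_riemannZeta_two_mul_sub_one).add (hs.mul_const (1 / 2))
  have e : G 1 * Real.eulerMascheroniConstant +
      (-2 * Real.pi * Real.log y - 4 * Real.pi * Real.log 2) * (1 / 2) =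
      2 * Real.pi * Real.eulerMascheroniConstant - Real.pi * Real.log y -
        2 * Real.pi * Real.log 2 := by rw [hG1]; ring
  rw [e] at h
  refine h.congr' ?_
  filter_upwards [self_mem_nhdsWithin] with s hs
  have hs : 1 < s := hs
  have hs1 : s - 1 ≠ 0 := by linarith
  rw [integral_one_add_sq_rpow_neg (by linarith), slope_def_field, hG1,
    ← tsum_nat_rpow_neg_eq_riemannZeta (show 1 < 2 * s - 1 by linarith),
    show (1 - 2 * s) = -(2 * s - 1) by ring]
  simp only [hG]
  field_simp
  ring

/-! ### Summation by rows and the limit along real `s` -/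

section rows

variable (z : UpperHalfPlane)

lemma latticeForm_rpow_neg_eq (m n : ℤ) (s : ℝ) :
    latticeForm z (m, n) ^ (-s) = z.im ^ s * ((m * z.re + n) ^ 2 + (m * z.im) ^ 2) ^ (-s) := by
  have hy := z.im_pos
  rw [latticeForm_eq, Real.div_rpow (by positivity) hy.le, Real.rpow_neg hy.le s, div_inv_eq_mul,
    mul_comm]

lemma tsum_latticeForm_row_zero {s : ℝ} (hs : 1 < s) :
    ∑' n : ℤ, latticeForm z (0, n) ^ (-s) = 2 * z.im ^ s * ∑' n : ℕ, ((n : ℝ) + 1) ^ (-(2 * s)) := by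
  have hsum : Summable fun n : ℤ => latticeForm z (0, n) ^ (-s) :=
    (summable_latticeForm_rpow z hs).prod_factor 0
  obtain ⟨f, hf⟩ : ∃ f : ℤ → ℝ, ∀ n, f n = latticeForm z (0, n) ^ (-s) := ⟨_, fun _ => rfl⟩
  rw [← summable_congr hf] at hsum
  rw [← tsum_congr hf]
  have hp : ∀ n : ℕ, f (n + 1) = z.im ^ s * ((n : ℝ) + 1) ^ (-(2 * s)) := by
    intro n
    have hn : (0 : ℝ) < (n : ℝ) + 1 := by positivity
    rw [hf, latticeForm_rpow_neg_eq]
    congr 1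
    have : -(2 * s) = (2 : ℕ) * (-s) := by push_cast; ring
    rw [this, Real.rpow_mul hn.le, Real.rpow_natCast]
    congr 1
    push_cast
    ring
  have hn : ∀ n : ℕ, f (-(n + 1)) = z.im ^ s * ((n : ℝ) + 1) ^ (-(2 * s)) := by
    intro n
    rw [← hp, hf, hf, latticeForm_rpow_neg_eq, latticeForm_rpow_neg_eq]
    congr 2
    push_cast
    ring
  -- The origin contributes nothing, since `0 ^ (-s) = 0` for real powers with nonzero exponent.
  have h0 : f 0 = 0 := by
    rw [hf, show ((0 : ℤ), (0 : ℤ)) = 0 from rfl, latticeForm_zero,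
      Real.zero_rpow (by linarith)]
  have hS := (summable_nat_add_one_rpow_neg (s := 2 * s) (by linarith)).mul_left (z.im ^ s)
  rw [tsum_of_add_one_of_neg_add_one ((summable_congr hp).mpr hS) ((summable_congr hn).mpr hS),
    tsum_congr hp, tsum_congr hn, tsum_mul_left, h0]
  ring

lemma tsum_latticeForm_row_neg (m : ℤ) (s : ℝ) :
    ∑' n : ℤ, latticeForm z (-m, n) ^ (-s) = ∑' n : ℤ, latticeForm z (m, n) ^ (-s) := by
  rw [← (Equiv.neg ℤ).tsum_eq]
  refine tsum_congr fun n => ?_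
  congr 1
  rw [latticeForm_eq, latticeForm_eq]
  simp only [Equiv.neg_apply]
  push_cast
  ring

/-- The difference between the sum over a row of the lattice and its main term. -/
noncomputable def latticeRowError (s : ℝ) (k : ℕ) : ℝ :=
  z.im ^ s * (∑' n : ℤ, (((k + 1 : ℝ) * z.re + n) ^ 2 + ((k + 1 : ℝ) * z.im) ^ 2) ^ (-s) -
    ((k + 1 : ℝ) * z.im) ^ (1 - 2 * s) * ∫ u : ℝ, (1 + u ^ 2) ^ (-s))

lemma tsum_latticeForm_row_succ (s : ℝ) (k : ℕ) :
    ∑' n : ℤ, latticeForm z ((k + 1 : ℤ), n) ^ (-s) = latticeRowError z s k +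
      z.im ^ (1 - s) * (∫ u : ℝ, (1 + u ^ 2) ^ (-s)) * ((k : ℝ) + 1) ^ (1 - 2 * s) := by
  have hy := z.im_pos
  have hk : (0 : ℝ) < (k : ℝ) + 1 := by positivity
  simp_rw [latticeForm_rpow_neg_eq]
  rw [tsum_mul_left, latticeRowError, mul_sub, Real.mul_rpow hk.le hy.le]
  have h : z.im ^ (1 - s) = z.im ^ s * z.im ^ (1 - 2 * s) := by
    rw [← Real.rpow_add hy]
    congr 1
    ring
  rw [h]
  push_cast
  ring

/-- Summable in `k` and uniform in `s ∈ [1, 2]`, so the limit `s ↓ 1` passes through the sum over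
rows. -/
lemma abs_latticeRowError_le {s : ℝ} (h1 : 1 ≤ s) (h2 : s ≤ 2) (k : ℕ) :
    |latticeRowError z s k| ≤
      2 * Real.pi * (z.im ^ (-1 : ℝ) + z.im ^ (-2 : ℝ)) * ((k : ℝ) + 1) ^ (-2 : ℝ) := by
  have hy := z.im_pos
  have hk : (0 : ℝ) < (k : ℝ) + 1 := by positivity
  have hs0 : 0 < s := by linarith
  have h := abs_tsum_shifted_sub_le (mul_pos hk hy) h1 (((k : ℝ) + 1) * z.re)
  rw [latticeRowError, abs_mul, abs_of_pos (Real.rpow_pos_of_pos hy s)]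
  refine (mul_le_mul_of_nonneg_left h (Real.rpow_nonneg hy.le s)).trans ?_
  rw [Real.mul_rpow hk.le hy.le]
  have h3 : z.im ^ s * z.im ^ (-(2 * s)) = z.im ^ (-s) := by
    rw [← Real.rpow_add hy]
    congr 1
    ring
  have h4 : ((k : ℝ) + 1) ^ (-(2 * s)) ≤ ((k : ℝ) + 1) ^ (-2 : ℝ) :=
    Real.rpow_le_rpow_of_exponent_le (by linarith [show (0 : ℝ) ≤ k by positivity]) (by linarith)
  calc _ = s * Real.pi * (z.im ^ s * z.im ^ (-(2 * s))) * ((k : ℝ) + 1) ^ (-(2 * s)) := by ring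
    _ ≤ _ := by
      rw [h3]
      have := Real.rpow_neg_le_add_of_mem_Icc hy h1 h2
      have := Real.rpow_nonneg hy.le (-s)
      gcongr

lemma tendsto_latticeRowError (k : ℕ) :
    Tendsto (fun s => latticeRowError z s k) (𝓝[>] 1) (𝓝 (latticeRowError z 1 k)) := by
  have hy := z.im_pos
  have hk : (0 : ℝ) < (k : ℝ) + 1 := by positivity
  have hb := mul_pos hk hy
  have h1 : Tendsto (fun s : ℝ => z.im ^ s) (𝓝[>] 1) (𝓝 (z.im ^ (1 : ℝ))) :=
    ((Real.continuousAt_const_rpow hy.ne').tendsto).mono_left nhdsWithin_le_nhds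
  have h2 : Tendsto (fun s : ℝ => (((k : ℝ) + 1) * z.im) ^ (1 - 2 * s)) (𝓝[>] 1)
      (𝓝 ((((k : ℝ) + 1) * z.im) ^ (1 - 2 * (1 : ℝ)))) := by
    have : ContinuousAt (fun s : ℝ => (((k : ℝ) + 1) * z.im) ^ (1 - 2 * s)) 1 :=
      ContinuousAt.comp (g := fun t : ℝ => (((k : ℝ) + 1) * z.im) ^ t)
        (Real.continuousAt_const_rpow hb.ne') (by fun_prop)
    exact this.tendsto.mono_left nhdsWithin_le_nhds
  have h3 : Tendsto (fun s : ℝ => ∫ u : ℝ, (1 + u ^ 2) ^ (-s)) (𝓝[>] 1)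
      (𝓝 (∫ u : ℝ, (1 + u ^ 2) ^ (-(1 : ℝ)))) := by
    have hd := (hasDerivAt_rpow_mul_Gamma_div_Gamma one_pos).continuousAt.tendsto.mono_left
      (nhdsWithin_le_nhds (s := Set.Ioi 1))
    rw [integral_one_add_sq_rpow_neg (by norm_num)]
    have hd2 := hd.div_const 2
    simp only [Real.one_rpow, mul_one] at hd2
    refine (hd2.congr' ?_).trans_eq ?_
    · filter_upwards [self_mem_nhdsWithin] with s hs
      rw [integral_one_add_sq_rpow_neg (lt_trans (by norm_num) hs)]
      ring
    · congr 1
      ring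
  exact h1.mul ((tendsto_tsum_shifted_sq_add_sq_rpow_neg hb _).sub (h2.mul h3))

/-- Apply the cotangent identity at `(k + 1) z`. Its constant term `π` is exactly the integral
subtracted in the error, so only the `q`-series survives. -/
lemma latticeRowError_one (k : ℕ) :
    latticeRowError z 1 k = 2 * Real.pi *
      ((∑' n : ℕ, Function.Periodic.qParam 1 (z : ℂ) ^ ((n + 1) * (k + 1))).re / (k + 1)) := by
  have hy := z.im_pos
  have hk : (0 : ℝ) < (k : ℝ) + 1 := by positivity
  have h := tsum_im_div_shifted ⟨((k : ℂ) + 1) * z, by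
    have : ((k : ℂ) + 1) * z = ((k + 1 : ℝ) : ℂ) * z := by push_cast; rfl
    rw [this, Complex.im_ofReal_mul]
    exact mul_pos hk hy⟩
  have him : (((k : ℂ) + 1) * (z : ℂ)).im = ((k : ℝ) + 1) * z.im := by
    have : ((k : ℂ) + 1) * z = ((k + 1 : ℝ) : ℂ) * z := by push_cast; rfl
    rw [this, Complex.im_ofReal_mul]
    rfl
  have hre : (((k : ℂ) + 1) * (z : ℂ)).re = ((k : ℝ) + 1) * z.re := by
    have : ((k : ℂ) + 1) * z = ((k + 1 : ℝ) : ℂ) * z := by push_cast; rfl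
    rw [this, Complex.re_ofReal_mul]
    rfl
  have hq : ∀ n : ℕ, Function.Periodic.qParam 1 (((k : ℂ) + 1) * (z : ℂ)) ^ (n + 1) =
      Function.Periodic.qParam 1 (z : ℂ) ^ ((n + 1) * (k + 1)) := by
    intro n
    rw [Function.Periodic.qParam, Function.Periodic.qParam, ← Complex.exp_nat_mul,
      ← Complex.exp_nat_mul]
    congr 1
    push_cast
    ring
  simp only [UpperHalfPlane.im, UpperHalfPlane.re] at h
  rw [him, hre] at h
  simp_rw [hq] at h
  rw [latticeRowError, integral_one_add_sq_rpow_neg_one, Real.rpow_one]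
  have h1 : (((k : ℝ) + 1) * z.im) ^ (1 - 2 * (1 : ℝ)) = (((k : ℝ) + 1) * z.im)⁻¹ := by
    rw [← Real.rpow_neg_one]
    norm_num
  rw [h1]
  set S := ∑' n : ℤ, ((((k : ℝ) + 1) * z.re + n) ^ 2 + (((k : ℝ) + 1) * z.im) ^ 2) ^ (-1 : ℝ)
  have h2 : z.im * S = (Real.pi + 2 * Real.pi *
      (∑' n : ℕ, Function.Periodic.qParam 1 (z : ℂ) ^ ((n + 1) * (k + 1))).re) / (k + 1) := by
    rw [← h]
    field_simp
  rw [mul_sub, h2]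
  field_simp
  ring

lemma tsum_latticeForm_rpow_eq {s : ℝ} (h1 : 1 < s) (h2 : s ≤ 2) :
    ∑' v, latticeForm z v ^ (-s) = 2 * z.im ^ s * (riemannZeta ((2 * s : ℝ) : ℂ)).re +
      2 * (∑' k, latticeRowError z s k) + 2 * (z.im ^ (1 - s) * (∫ u : ℝ, (1 + u ^ 2) ^ (-s)) *
        ∑' n : ℕ, ((n : ℝ) + 1) ^ (1 - 2 * s)) := by
  have hS := summable_latticeForm_rpow z h1
  have hE : Summable (latticeRowError z s) :=
    Summable.of_norm_bounded ((summable_nat_add_one_rpow_neg one_lt_two).mul_left _)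
      (abs_latticeRowError_le z h1.le h2)
  have hZ : Summable fun n : ℕ => ((n : ℝ) + 1) ^ (1 - 2 * s) := by
    have := summable_nat_add_one_rpow_neg (s := 2 * s - 1) (by linarith)
    simpa using this
  have hM := hZ.mul_left (z.im ^ (1 - s) * (∫ u : ℝ, (1 + u ^ 2) ^ (-s)))
  obtain ⟨R, hR⟩ : ∃ R : ℤ → ℝ, ∀ m, R m = ∑' n, latticeForm z (m, n) ^ (-s) := ⟨_, fun _ => rfl⟩
  have hp : ∀ k : ℕ, R (k + 1) = latticeRowError z s k +
      z.im ^ (1 - s) * (∫ u : ℝ, (1 + u ^ 2) ^ (-s)) * ((k : ℝ) + 1) ^ (1 - 2 * s) :=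
    fun k => (hR _).trans (tsum_latticeForm_row_succ z s k)
  have hn : ∀ k : ℕ, R (-(k + 1)) = latticeRowError z s k +
      z.im ^ (1 - s) * (∫ u : ℝ, (1 + u ^ 2) ^ (-s)) * ((k : ℝ) + 1) ^ (1 - 2 * s) := by
    intro k
    rw [← hp, hR, hR, tsum_latticeForm_row_neg]
  rw [hS.tsum_prod, ← tsum_congr hR,
    tsum_of_add_one_of_neg_add_one ((summable_congr hp).mpr (hE.add hM))
      ((summable_congr hn).mpr (hE.add hM)), tsum_congr hp, tsum_congr hn, hE.tsum_add hM,
    tsum_mul_left, hR 0, tsum_latticeForm_row_zero z h1,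
    tsum_nat_rpow_neg_eq_riemannZeta (by linarith)]
  ring

lemma tendsto_tsum_latticeForm_rpow_sub :
    Tendsto (fun s : ℝ => ∑' v, latticeForm z v ^ (-s) - Real.pi / (s - 1)) (𝓝[>] 1)
      (𝓝 (2 * Real.pi * Real.eulerMascheroniConstant - 2 * Real.pi * Real.log 2 -
        Real.pi * Real.log z.im - 4 * Real.pi * Real.log ‖ModularForm.eta (z : ℂ)‖)) := by
  have hy := z.im_pos
  have h1 : Tendsto (fun s : ℝ => 2 * z.im ^ s * (riemannZeta ((2 * s : ℝ) : ℂ)).re) (𝓝[>] 1)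
      (𝓝 (2 * z.im ^ (1 : ℝ) * (Real.pi ^ 2 / 6))) := by
    have : Tendsto (fun s : ℝ => z.im ^ s) (𝓝[>] 1) (𝓝 (z.im ^ (1 : ℝ))) :=
      ((Real.continuousAt_const_rpow hy.ne').tendsto).mono_left nhdsWithin_le_nhds
    exact (this.const_mul 2).mul tendsto_re_riemannZeta_two_mul
  have h2 : Tendsto (fun s : ℝ => ∑' k, latticeRowError z s k) (𝓝[>] 1)
      (𝓝 (∑' k, latticeRowError z 1 k)) := by
    refine tendsto_tsum_of_dominated_convergence
      ((summable_nat_add_one_rpow_neg one_lt_two).mul_left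
        (2 * Real.pi * (z.im ^ (-1 : ℝ) + z.im ^ (-2 : ℝ)))) (tendsto_latticeRowError z) ?_
    filter_upwards [Ioc_mem_nhdsGT (show (1 : ℝ) < 2 by norm_num)] with s hs k
    exact abs_latticeRowError_le z hs.1.le hs.2 k
  have h := (h1.add (h2.const_mul 2)).add (tendsto_two_mul_rpow_mul_integral_mul_zeta hy)
  -- Taken `2` times, the part with `π y / 12` is `-π² y / 3`, which cancels the limit of the row `m
  -- = 0`.
  have h3 : ∑' k, latticeRowError z 1 k = 2 * Real.pi *
      (-(Real.pi * z.im / 12) - Real.log ‖ModularForm.eta (z : ℂ)‖) := by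
    simp_rw [latticeRowError_one]
    rw [tsum_mul_left, log_norm_eta]
    ring
  rw [h3, Real.rpow_one] at h
  refine (h.congr' ?_).trans_eq ?_
  · filter_upwards [Ioc_mem_nhdsGT (show (1 : ℝ) < 2 by norm_num)] with s hs
    rw [tsum_latticeForm_rpow_eq z hs.1 hs.2]
    ring
  · congr 1
    ring

end rows

/-- The Kronecker limit formula for the Epstein zeta function. -/
theorem tendsto_epsteinZeta_sub (z : UpperHalfPlane) :
    Tendsto (fun s => epsteinZeta z s - Real.pi / (s - 1)) (𝓝[≠] 1)
      (𝓝 ((2 * Real.pi * Real.eulerMascheroniConstant - 2 * Real.pi * Real.log 2 -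
        Real.pi * Real.log z.im - 4 * Real.pi * Real.log ‖ModularForm.eta (z : ℂ)‖ : ℝ) : ℂ)) := by
  obtain ⟨K, hK⟩ := exists_tendsto_epsteinZeta_sub z
  have h1 : Tendsto (fun s : ℝ => (s : ℂ)) (𝓝[>] 1) (𝓝[≠] 1) := by
    refine tendsto_nhdsWithin_of_tendsto_nhds_of_eventually_within _ ?_ ?_
    · exact (Complex.continuous_ofReal.tendsto' 1 1 (by simp)).mono_left nhdsWithin_le_nhds
    · filter_upwards [self_mem_nhdsWithin] with s hs
      have : s ≠ 1 := ne_of_gt hs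
      simpa using this
  have h2 := (Complex.continuous_ofReal.tendsto _).comp (tendsto_tsum_latticeForm_rpow_sub z)
  have h3 := hK.comp h1
  -- The complex limit exists, so the limit along real `s ↓ 1` identifies it.
  refine tendsto_nhds_unique (h3.congr' ?_) h2 ▸ hK
  filter_upwards [self_mem_nhdsWithin] with s hs
  have hs : 1 < s := hs
  have e : epsteinZeta z s = ((∑' v, latticeForm z v ^ (-s) : ℝ) : ℂ) := by
    rw [← (hasSum_epsteinZeta z (s := s) (by simpa using hs)).tsum_eq, Complex.ofReal_tsum]
    refine tsum_congr fun v => ?_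
    rw [← Complex.ofReal_cpow (inv_nonneg.mpr (latticeForm_nonneg z v)),
      Real.inv_rpow (latticeForm_nonneg z v), Real.rpow_neg (latticeForm_nonneg z v)]
  rw [Function.comp_apply, Function.comp_apply, e]
  push_cast
  rfl

/-! ### Coprime pairs and the condition `p ∣ c` -/

/-- The summands of the sum over coprime pairs. -/
noncomputable def coprimeTerm (z : UpperHalfPlane) (s : ℂ) (v : ℤ × ℤ) : ℂ :=
  if IsCoprime v.1 v.2 then (((latticeForm z v)⁻¹ : ℝ) : ℂ) ^ s else 0

lemma inv_mul_cpow_of_nonneg {a b : ℝ} (ha : 0 ≤ a) (hb : 0 ≤ b) (s : ℂ) :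
    (((a * b)⁻¹ : ℝ) : ℂ) ^ s = ((a : ℂ) ^ s)⁻¹ * ((b⁻¹ : ℝ) : ℂ) ^ s := by
  rw [mul_inv, Complex.ofReal_mul, Complex.mul_cpow_ofReal_nonneg (inv_nonneg.mpr ha)
    (inv_nonneg.mpr hb), Complex.ofReal_inv a, Complex.inv_cpow]
  rw [Complex.arg_ofReal_of_nonneg ha]
  exact Real.pi_pos.ne

lemma latticeForm_mul (z : UpperHalfPlane) (k : ℤ) (v : ℤ × ℤ) :
    latticeForm z (k * v.1, k * v.2) = (k : ℝ) ^ 2 * latticeForm z v := by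
  rw [latticeForm_eq, latticeForm_eq]
  push_cast
  ring

/-- A nonzero vector is uniquely `k + 1` times a coprime pair, with `k + 1` its gcd. By homogeneity
the whole sum factors as `ζ(s)` times the coprime sum, and `ζ(s) ≠ 0` for `Re s > 1`. -/
lemma hasSum_isCoprime_of_homogeneous {h : ℤ × ℤ → ℂ} {s G : ℂ} (hs : 1 < s.re) (h0 : h 0 = 0)
    (hmul : ∀ (k : ℕ) (v : ℤ × ℤ), h ((k + 1 : ℤ) * v.1, (k + 1 : ℤ) * v.2) =
      1 / ((k : ℂ) + 1) ^ s * h v) (hsum : HasSum h G) :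
    HasSum (fun v => if IsCoprime v.1 v.2 then h v else 0) (G / riemannZeta s) := by
  let C : Set (ℤ × ℤ) := {v | IsCoprime v.1 v.2}
  let g : ℕ × C → ℤ × ℤ := fun w => ((w.1 + 1 : ℤ) * w.2.1.1, (w.1 + 1 : ℤ) * w.2.1.2)
  have hgcd : ∀ w, Int.gcd (g w).1 (g w).2 = w.1 + 1 := by
    rintro ⟨k, v, hv⟩
    simp only [g]
    rw [Int.gcd_mul_left, Int.isCoprime_iff_gcd_eq_one.mp hv, mul_one]
    norm_cast
  have hg : Function.Injective g := by
    rintro ⟨k, v, hv⟩ ⟨l, w, hw⟩ hkl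
    have h1 : k = l := by
      have := (hgcd ⟨k, v, hv⟩).symm.trans ((congrArg (fun u : ℤ × ℤ => Int.gcd u.1 u.2) hkl).trans
        (hgcd ⟨l, w, hw⟩))
      simpa using this
    subst h1
    have hk : (k + 1 : ℤ) ≠ 0 := by positivity
    have h2 := congrArg Prod.fst hkl
    have h3 := congrArg Prod.snd hkl
    simp only [g] at h2 h3
    have h4 : v = w := Prod.ext (mul_left_cancel₀ hk h2) (mul_left_cancel₀ hk h3)
    subst h4
    rfl
  have hrange : ∀ v ∉ Set.range g, h v = 0 := by
    intro v hv
    by_cases hv0 : v = 0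
    · rw [hv0, h0]
    · exfalso
      apply hv
      have hpos : 0 < Int.gcd v.1 v.2 := by
        rw [Int.gcd_pos_iff]
        by_contra! hcon
        exact hv0 (Prod.ext hcon.1 hcon.2)
      obtain ⟨a, b, hab, ha, hb⟩ := Int.exists_gcd_one hpos
      refine ⟨(Int.gcd v.1 v.2 - 1, ⟨(a, b), Int.isCoprime_iff_gcd_eq_one.mpr hab⟩), ?_⟩
      have e : ((Int.gcd v.1 v.2 - 1 : ℕ) : ℤ) + 1 = (Int.gcd v.1 v.2 : ℤ) := by
        rw [Nat.cast_sub hpos]; simp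
      refine Prod.ext ?_ ?_
      · simp only [g, e]
        linarith
      · simp only [g, e]
        linarith
  have hsum' : HasSum (fun w : ℕ × C => 1 / ((w.1 : ℂ) + 1) ^ s * h w.2) G :=
    ((hg.hasSum_iff hrange).mpr hsum).congr_fun fun w => (hmul w.1 w.2).symm
  have hsC : Summable fun v : C => h v := by
    have := hsum'.summable.prod_factor 0
    simpa using this
  have h1 : HasSum (fun k : ℕ => 1 / ((k : ℂ) + 1) ^ s * ∑' v : C, h v) G :=
    hsum'.prod_fiberwise (fun k => hsC.hasSum.mul_left (1 / ((k : ℂ) + 1) ^ s))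
  have h2 : HasSum (fun k : ℕ => 1 / ((k : ℂ) + 1) ^ s) (riemannZeta s) := by
    rw [zeta_eq_tsum_one_div_nat_add_one_cpow hs]
    refine Summable.hasSum ?_
    have := (summable_nat_add_iff 1).mpr (Complex.summable_one_div_nat_cpow.mpr hs)
    simpa using this
  have h3 := h1.unique (h2.mul_right _)
  rw [h3, mul_div_cancel_left₀ _ (riemannZeta_ne_zero_of_one_lt_re hs)]
  refine (hasSum_subtype_iff_indicator.mp hsC.hasSum).congr_fun fun v => ?_
  rw [Set.indicator_apply]
  rfl

lemma hasSum_coprimeTerm (z : UpperHalfPlane) {s : ℂ} (hs : 1 < s.re) :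
    HasSum (coprimeTerm z s) (epsteinZeta z s / riemannZeta (2 * s)) := by
  have hs0 : s ≠ 0 := by
    rintro rfl
    simp at hs
    linarith
  have hs2 : 1 < (2 * s).re := by simp; linarith
  refine hasSum_isCoprime_of_homogeneous hs2 ?_ ?_ (hasSum_epsteinZeta z hs)
  · simp [latticeForm_zero, Complex.zero_cpow hs0]
  · intro k v
    have hk : (0 : ℝ) ≤ (k : ℝ) + 1 := by positivity
    rw [latticeForm_mul, inv_mul_cpow_of_nonneg (by positivity) (latticeForm_nonneg z _), one_div]
    congr 2
    have : ((((k + 1 : ℤ) : ℝ) ^ 2 : ℝ) : ℂ) = ((k + 1 : ℝ) : ℂ) * ((k + 1 : ℝ) : ℂ) := by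
      push_cast
      ring
    rw [this, Complex.mul_cpow_ofReal_nonneg hk hk, Complex.cpow_ofNat_mul, sq]
    push_cast
    rfl

/-- The point `p z` of the upper half-plane. -/
noncomputable def scaledPoint (p : ℕ) [NeZero p] (z : UpperHalfPlane) : UpperHalfPlane :=
  ⟨(p : ℂ) * z, by
    have : (p : ℂ) * z = ((p : ℝ) : ℂ) * z := by push_cast; rfl
    rw [this, Complex.im_ofReal_mul]
    exact mul_pos (Nat.cast_pos.mpr (NeZero.pos p)) z.im_pos⟩

section

variable (p : ℕ) [NeZero p] (z : UpperHalfPlane)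

lemma scaledPoint_im : (scaledPoint p z).im = p * z.im := by
  have : (p : ℂ) * z = ((p : ℝ) : ℂ) * z := by push_cast; rfl
  change ((p : ℂ) * z).im = _
  rw [this, Complex.im_ofReal_mul]
  rfl

lemma scaledPoint_re : (scaledPoint p z).re = p * z.re := by
  have : (p : ℂ) * z = ((p : ℝ) : ℂ) * z := by push_cast; rfl
  change ((p : ℂ) * z).re = _
  rw [this, Complex.re_ofReal_mul]
  rfl

lemma latticeForm_mul_left (c d : ℤ) :
    latticeForm z (p * c, d) = p * latticeForm (scaledPoint p z) (c, d) := by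
  have hp : (p : ℝ) ≠ 0 := Nat.cast_ne_zero.mpr (NeZero.ne p)
  have hy := z.im_pos.ne'
  rw [latticeForm_eq, latticeForm_eq, scaledPoint_im, scaledPoint_re]
  push_cast
  field_simp

lemma latticeForm_scaledPoint_mul_right (c d : ℤ) :
    latticeForm (scaledPoint p z) (c, p * d) = p * latticeForm z (c, d) := by
  have hp : (p : ℝ) ≠ 0 := Nat.cast_ne_zero.mpr (NeZero.ne p)
  have hy := z.im_pos.ne'
  rw [latticeForm_eq, latticeForm_eq, scaledPoint_im, scaledPoint_re]
  push_cast
  field_simp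

end

/-- In the application `f` and `g` are the coprime summands at `z` and `p z`, and `x = p ^ s`. Pairs
with `p ∤ d` at `p z` correspond to pairs `(p c, d)` at `z`, and pairs `(c, p d)` at `p z` to pairs
with `p ∤ c` at `z`. This expresses `G` through `F` and the wanted sum. -/
lemma hasSum_dvd_fst_of_hasSum {p : ℤ} (hp : p ≠ 0) {f g : ℤ × ℤ → ℂ} {F G x : ℂ} (hx : x ≠ 0)
    (hx2 : x ^ 2 ≠ 1) (hf : HasSum f F) (hg : HasSum g G)
    (h1 : ∀ c d, ¬ p ∣ d → g (c, d) = x * f (p * c, d)) (h1' : ∀ c d, p ∣ d → f (p * c, d) = 0)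
    (h2 : ∀ c d, ¬ p ∣ c → g (c, p * d) = x⁻¹ * f (c, d)) (h2' : ∀ c d, p ∣ c → g (c, p * d) = 0) :
    HasSum (fun v => if p ∣ v.1 then f v else 0) ((x * G - F) / (x ^ 2 - 1)) := by
  obtain ⟨fa, hfa⟩ : ∃ fa : ℤ × ℤ → ℂ, ∀ v, fa v = if p ∣ v.1 then f v else 0 := ⟨_, fun _ => rfl⟩
  obtain ⟨fb, hfb⟩ : ∃ fb : ℤ × ℤ → ℂ, ∀ v, fb v = if p ∣ v.1 then 0 else f v := ⟨_, fun _ => rfl⟩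
  obtain ⟨ga, hga⟩ : ∃ ga : ℤ × ℤ → ℂ, ∀ v, ga v = if p ∣ v.2 then 0 else g v := ⟨_, fun _ => rfl⟩
  obtain ⟨gb, hgb⟩ : ∃ gb : ℤ × ℤ → ℂ, ∀ v, gb v = if p ∣ v.2 then g v else 0 := ⟨_, fun _ => rfl⟩
  have hSa : Summable fa := by
    have := hf.summable.indicator {v : ℤ × ℤ | p ∣ v.1}
    refine this.congr fun v => ?_
    rw [hfa, Set.indicator_apply]
    rfl
  have hfab : ∀ v, f v = fa v + fb v := fun v => by
    rw [hfa, hfb]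
    split_ifs <;> simp
  have hgab : ∀ v, g v = ga v + gb v := fun v => by
    rw [hga, hgb]
    split_ifs <;> simp
  have hSb : HasSum fb (F - ∑' v, fa v) := by
    refine (hf.sub hSa.hasSum).congr_fun fun v => ?_
    rw [hfab]
    ring
  have hi1 : Function.Injective (fun v : ℤ × ℤ => (p * v.1, v.2)) := by
    rintro ⟨c, d⟩ ⟨c', d'⟩ h
    simpa [hp] using h
  have hi2 : Function.Injective (fun v : ℤ × ℤ => (v.1, p * v.2)) := by
    rintro ⟨c, d⟩ ⟨c', d'⟩ h
    simpa [hp] using h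
  have hA : HasSum (fun v : ℤ × ℤ => fa (p * v.1, v.2)) (∑' v, fa v) := by
    refine (hi1.hasSum_iff ?_).mpr hSa.hasSum
    rintro ⟨c, d⟩ hv
    rw [hfa, if_neg]
    rintro ⟨e, he⟩
    exact hv ⟨(e, d), Prod.ext he.symm rfl⟩
  have hGa : HasSum ga (x * ∑' v, fa v) := by
    refine (hA.mul_left x).congr_fun ?_
    rintro ⟨c, d⟩
    rw [hga, hfa, if_pos (Dvd.intro _ rfl)]
    by_cases h : p ∣ d
    · rw [if_pos h, h1' c d h, mul_zero]
    · rw [if_neg h, h1 c d h]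
  have hGb : HasSum gb (x⁻¹ * (F - ∑' v, fa v)) := by
    refine (hi2.hasSum_iff ?_).mp ((hSb.mul_left x⁻¹).congr_fun ?_)
    · rintro ⟨c, d⟩ hv
      rw [hgb, if_neg]
      rintro ⟨e, he⟩
      exact hv ⟨(c, e), Prod.ext rfl he.symm⟩
    · rintro ⟨c, d⟩
      rw [Function.comp_apply, hgb, hfb, if_pos (Dvd.intro _ rfl)]
      by_cases h : p ∣ c
      · rw [if_pos h, h2' c d h, mul_zero]
      · rw [if_neg h, h2 c d h]
  have hG : G = x * ∑' v, fa v + x⁻¹ * (F - ∑' v, fa v) :=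
    hg.unique ((hGa.add hGb).congr_fun fun v => hgab v)
  have hval : (x * G - F) / (x ^ 2 - 1) = ∑' v, fa v := by
    rw [div_eq_iff (sub_ne_zero.mpr hx2), hG]
    field_simp
    ring
  rw [hval]
  exact hSa.hasSum.congr_fun fun v => (hfa v).symm

lemma norm_natCast_cpow_gt_one {p : ℕ} (hp : 1 < p) {s : ℂ} (hs : 0 < s.re) : 1 < ‖(p : ℂ) ^ s‖ := by
  rw [Complex.norm_natCast_cpow_of_pos (by lia)]
  exact Real.one_lt_rpow (by exact_mod_cast hp) hs

/-- The sum over the bottom rows of the elements of `Γ₀(p)`. -/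
lemma hasSum_coprimeTerm_dvd {p : ℕ} (hp : p.Prime) [NeZero p] (z : UpperHalfPlane) {s : ℂ}
    (hs : 1 < s.re) :
    HasSum (fun v => if (p : ℤ) ∣ v.1 then coprimeTerm z s v else 0)
      (((p : ℂ) ^ s * epsteinZeta (scaledPoint p z) s - epsteinZeta z s) /
        (riemannZeta (2 * s) * (((p : ℂ) ^ s) ^ 2 - 1))) := by
  have hp0 : (p : ℂ) ≠ 0 := Nat.cast_ne_zero.mpr hp.ne_zero
  have hpp : Prime (p : ℤ) := Nat.prime_iff_prime_int.mp hp
  have hps : (p : ℂ) ^ s ≠ 0 := (Complex.cpow_ne_zero_iff (y := s)).mpr (Or.inl hp0)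
  have hps2 : ((p : ℂ) ^ s) ^ 2 ≠ 1 := by
    intro h
    have h1 := congrArg norm h
    rw [norm_pow, norm_one] at h1
    exact (one_lt_pow₀ (norm_natCast_cpow_gt_one hp.one_lt (by linarith)) two_ne_zero).ne' h1
  have hcop : ∀ c d : ℤ, IsCoprime ((p : ℤ) * c) d ↔ ¬ (p : ℤ) ∣ d ∧ IsCoprime c d := by
    intro c d
    rw [IsCoprime.mul_left_iff, hpp.coprime_iff_not_dvd]
  have hcop' : ∀ c d : ℤ, IsCoprime c ((p : ℤ) * d) ↔ ¬ (p : ℤ) ∣ c ∧ IsCoprime c d := by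
    intro c d
    rw [isCoprime_comm, hcop, isCoprime_comm]
  have h := hasSum_dvd_fst_of_hasSum (p := p) hpp.ne_zero hps hps2 (hasSum_coprimeTerm z hs)
    (hasSum_coprimeTerm (scaledPoint p z) hs) ?_ ?_ ?_ ?_
  · convert! h using 1
    field_simp
  · intro c d hd
    by_cases h2 : IsCoprime c d
    · rw [coprimeTerm, coprimeTerm, if_pos h2, if_pos ((hcop c d).mpr ⟨hd, h2⟩),
        latticeForm_mul_left, inv_mul_cpow_of_nonneg (Nat.cast_nonneg p) (latticeForm_nonneg _ _),
        Complex.ofReal_natCast, mul_inv_cancel_left₀ hps]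
    · rw [coprimeTerm, coprimeTerm, if_neg h2, if_neg (fun h => h2 ((hcop c d).mp h).2), mul_zero]
  · intro c d hd
    rw [coprimeTerm, if_neg (fun h => ((hcop c d).mp h).1 hd)]
  · intro c d hc
    by_cases h2 : IsCoprime c d
    · rw [coprimeTerm, coprimeTerm, if_pos h2, if_pos ((hcop' c d).mpr ⟨hc, h2⟩),
        latticeForm_scaledPoint_mul_right, inv_mul_cpow_of_nonneg (Nat.cast_nonneg p)
          (latticeForm_nonneg _ _), Complex.ofReal_natCast]
    · rw [coprimeTerm, coprimeTerm, if_neg h2, if_neg (fun h => h2 ((hcop' c d).mp h).2), mul_zero]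
  · intro c d hc
    rw [coprimeTerm, if_neg (fun h => ((hcop' c d).mp h).1 hc)]

/-! ### The Eisenstein series at `∞` as a sum over bottom rows -/

lemma im_specialLinearGroup_smul (g : SL(2, ℝ)) (z : UpperHalfPlane) :
    (g • z).im = z.im / Complex.normSq (g 1 0 * z + g 1 1) := by
  change (Matrix.SpecialLinearGroup.mapGL ℝ g • z).im = _
  rw [UpperHalfPlane.im_smul_eq_div_normSq]
  simp [UpperHalfPlane.denom]

lemma im_map_int_smul (g : SL(2, ℤ)) (z : UpperHalfPlane) :
    (Matrix.SpecialLinearGroup.map (Int.castRingHom ℝ) g • z).im =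
      (latticeForm z (g 1 0, g 1 1))⁻¹ := by
  rw [im_specialLinearGroup_smul, latticeForm, inv_div]
  simp

lemma unipotent_mem_gammaZero {p : ℕ} {x : ℝ} :
    unipotent x ∈ gammaZero p ↔ ∃ k : ℤ, x = k := by
  constructor
  · rintro ⟨γ, -, hγ⟩
    refine ⟨γ 0 1, ?_⟩
    have := congrArg (fun g : SL(2, ℝ) => g 0 1) hγ
    simpa [unipotent] using this.symm
  · rintro ⟨k, rfl⟩
    obtain ⟨g, hg⟩ : ∃ g : SL(2, ℤ), (g : Matrix (Fin 2) (Fin 2) ℤ) = !![1, k; 0, 1] :=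
      ⟨⟨_, by simp⟩, rfl⟩
    refine ⟨g, ?_, ?_⟩
    · change g ∈ CongruenceSubgroup.Gamma0 p
      rw [CongruenceSubgroup.Gamma0_mem, hg]
      simp
    · ext i j
      rw [Matrix.SpecialLinearGroup.map_apply_coe, hg]
      fin_cases i <;> fin_cases j <;> simp [unipotent]

lemma apply_one_zero_of_smul_infty {g : SL(2, ℝ)}
    (h : (g : GL (Fin 2) ℝ) • (OnePoint.infty : OnePoint ℝ) = OnePoint.infty) : g 1 0 = 0 := by
  simpa using OnePoint.smul_infty_eq_self_iff.mp h

lemma det_of_apply_one_zero {g : SL(2, ℝ)} (h : g 1 0 = 0) : g 0 0 * g 1 1 = 1 := by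
  have := g.det_coe
  rw [Matrix.det_fin_two, h] at this
  linarith

lemma conj_unipotent {g : SL(2, ℝ)} (h : g 1 0 = 0) (x : ℝ) :
    g * unipotent x * g⁻¹ = unipotent (g 0 0 ^ 2 * x) := by
  have hd := det_of_apply_one_zero h
  rw [mul_inv_eq_iff_eq_mul]
  apply Subtype.ext
  rw [Matrix.SpecialLinearGroup.coe_mul, Matrix.SpecialLinearGroup.coe_mul]
  ext i j
  rw [Matrix.mul_apply, Matrix.mul_apply, Fin.sum_univ_two, Fin.sum_univ_two]
  fin_cases i <;> fin_cases j <;> simp [unipotent, h]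
  linear_combination (-(g 0 0) * x) * hd

lemma isScalingMatrix_one (p : ℕ) : IsScalingMatrix (gammaZero p) OnePoint.infty 1 where
  map_infty := by simp
  conj_mem_iff x := by simp [unipotent_mem_gammaZero]

/-- Such a `τ` is upper triangular, and conjugation by it multiplies translations by `a²`, where `a`
is its upper left entry. It must preserve the integers, so `a²` and `a⁻²` are both integers and `a²
= 1`. -/
lemma IsScalingMatrix.im_inv_smul {p : ℕ} {τ : SL(2, ℝ)}
    (hτ : IsScalingMatrix (gammaZero p) OnePoint.infty τ) (z : UpperHalfPlane) :
    (τ⁻¹ • z).im = z.im := by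
  have hc := apply_one_zero_of_smul_infty hτ.map_infty
  have hd := det_of_apply_one_zero hc
  have h0 : τ 0 0 ≠ 0 := left_ne_zero_of_mul_eq_one hd
  have key : ∀ x : ℝ, (∃ k : ℤ, τ 0 0 ^ 2 * x = k) ↔ ∃ k : ℤ, x = k := by
    intro x
    have := hτ.conj_mem_iff x
    rwa [conj_unipotent hc, unipotent_mem_gammaZero] at this
  obtain ⟨k, hk⟩ := (key 1).mpr ⟨1, by simp⟩
  obtain ⟨l, hl⟩ := (key (τ 0 0 ^ 2)⁻¹).mp ⟨1, by simp [h0]⟩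
  rw [mul_one] at hk
  have hkl : (k : ℝ) * l = 1 := by
    rw [← hk, ← hl]
    field_simp
  have hk0 : 0 ≤ k := by
    have : (0 : ℝ) ≤ k := by rw [← hk]; positivity
    exact_mod_cast this
  have hk1 : k = 1 := Int.eq_one_of_mul_eq_one_right hk0 (by exact_mod_cast hkl)
  have ha : τ 0 0 ^ 2 = 1 := by rw [hk, hk1]; simp
  rw [im_specialLinearGroup_smul]
  have hn : Complex.normSq (((τ⁻¹ 1 0 : ℝ) : ℂ) * z + ((τ⁻¹ 1 1 : ℝ) : ℂ)) = 1 := by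
    rw [Matrix.SpecialLinearGroup.SL2_inv_expl]
    simp [hc]
    linarith
  rw [hn, div_one]

/-- An integral matrix representing the class `q`. -/
lemma exists_int_representative (p : ℕ) (q : CuspCosets (gammaZero p) OnePoint.infty) :
    ∃ g ∈ CongruenceSubgroup.Gamma0 p,
      Matrix.SpecialLinearGroup.map (Int.castRingHom ℝ) g = (q.out : SL(2, ℝ)) :=
  q.out.2

lemma mem_cuspStabilizer_infty {p : ℕ} {γ : gammaZero p} :
    γ ∈ cuspStabilizer (gammaZero p) OnePoint.infty ↔ (γ : SL(2, ℝ)) 1 0 = 0 := by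
  refine ⟨fun h => apply_one_zero_of_smul_infty h, fun h => ?_⟩
  change ((γ : SL(2, ℝ)) : GL (Fin 2) ℝ) • (OnePoint.infty : OnePoint ℝ) = OnePoint.infty
  rw [OnePoint.smul_infty_eq_self_iff]
  simpa using h

/-- Two integral matrices represent the same class in `Γ_∞ \ Γ` if their bottom rows are
proportional. -/
lemma cuspCosets_mk_eq_iff {p : ℕ} {γ δ : gammaZero p} :
    (Quotient.mk _ γ : CuspCosets (gammaZero p) OnePoint.infty) = Quotient.mk _ δ ↔
      (δ : SL(2, ℝ)) 1 0 * (γ : SL(2, ℝ)) 1 1 = (δ : SL(2, ℝ)) 1 1 * (γ : SL(2, ℝ)) 1 0 := by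
  rw [Quotient.eq, QuotientGroup.rightRel_apply, mem_cuspStabilizer_infty]
  rw [Subgroup.coe_mul, Subgroup.coe_inv, Matrix.SpecialLinearGroup.coe_mul, Matrix.mul_apply,
    Fin.sum_univ_two, Matrix.SpecialLinearGroup.SL2_inv_expl]
  simp [← sub_eq_add_neg, sub_eq_zero]

/-- A class together with a sign is the same as a coprime pair `(c, d)` with `p ∣ c`; both signs
give the same term, whence the division by `2`. -/
lemma hasSum_eisensteinTerm_infty {p : ℕ} {τ : SL(2, ℝ)}
    (hτ : IsScalingMatrix (gammaZero p) OnePoint.infty τ) (z : UpperHalfPlane) {s S : ℂ}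
    (h : HasSum (fun v => if (p : ℤ) ∣ v.1 then coprimeTerm z s v else 0) S) :
    HasSum (eisensteinTerm (gammaZero p) OnePoint.infty τ z s) (S / 2) := by
  choose g hg hgq using exists_int_representative p
  let row : CuspCosets (gammaZero p) OnePoint.infty × ℤˣ → ℤ × ℤ :=
    fun w => ((w.2 : ℤ) * g w.1 1 0, (w.2 : ℤ) * g w.1 1 1)
  have hcop : ∀ q, IsCoprime (g q 1 0) (g q 1 1) := fun q =>
    ModularGroup.bottom_row_coprime (g q)
  have hdvd : ∀ q, (p : ℤ) ∣ g q 1 0 := fun q => by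
    have := hg q
    rwa [CongruenceSubgroup.Gamma0_mem, ZMod.intCast_zmod_eq_zero_iff_dvd] at this
  have hcoe : ∀ q i j, (q.out : SL(2, ℝ)) i j = (g q i j : ℝ) := fun q i j => by
    rw [← hgq]
    simp
  have hinj : Function.Injective row := by
    rintro ⟨q, ε⟩ ⟨r, δ⟩ hqr
    have h1 : (ε : ℤ) * g q 1 0 = δ * g r 1 0 := congrArg Prod.fst hqr
    have h2 : (ε : ℤ) * g q 1 1 = δ * g r 1 1 := congrArg Prod.snd hqr
    have hεδ : IsUnit (ε * δ : ℤ) := ⟨ε * δ, by simp⟩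
    have hq : q = r := by
      rw [← Quotient.out_eq q, ← Quotient.out_eq r, cuspCosets_mk_eq_iff]
      simp only [hcoe]
      norm_cast
      apply hεδ.mul_left_cancel
      linear_combination (δ * g r 1 0 : ℤ) * h2 - (δ * g r 1 1 : ℤ) * h1
    subst hq
    have hε : (ε : ℤ) = δ := by
      obtain ⟨a, b, hab⟩ := hcop q
      linear_combination a * h1 + b * h2 - (ε - δ : ℤ) * hab
    rw [Units.ext hε]
  have hrange : ∀ v ∉ Set.range row,
      (if (p : ℤ) ∣ v.1 then coprimeTerm z s v else 0) = 0 := by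
    rintro ⟨c, d⟩ hv
    by_contra hne
    have hp : (p : ℤ) ∣ c := by
      by_contra hcon
      exact hne (if_neg hcon)
    rw [if_pos hp, coprimeTerm] at hne
    have hcd : IsCoprime c d := by
      by_contra hcon
      exact hne (if_neg hcon)
    obtain ⟨γ, -, hγ⟩ := ModularGroup.bottom_row_surj (R := ℤ) (a := ![c, d]) hcd
    have hγ0 : γ 1 0 = c := congrFun hγ 0
    have hγ1 : γ 1 1 = d := congrFun hγ 1
    have hγΓ : γ ∈ CongruenceSubgroup.Gamma0 p := by
      rw [CongruenceSubgroup.Gamma0_mem, hγ0, ZMod.intCast_zmod_eq_zero_iff_dvd]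
      exact hp
    let γ' : gammaZero p := ⟨_, ⟨γ, hγΓ, rfl⟩⟩
    obtain ⟨q, hq⟩ : ∃ q : CuspCosets (gammaZero p) OnePoint.infty, q = Quotient.mk _ γ' :=
      ⟨_, rfl⟩
    have hqγ := hq
    rw [← Quotient.out_eq q, cuspCosets_mk_eq_iff] at hqγ
    simp only [hcoe] at hqγ
    have h1 : c * g q 1 1 = d * g q 1 0 := by
      rw [← hγ0, ← hγ1]
      have : ((γ 1 0 : ℤ) : ℝ) * (g q 1 1 : ℤ) = (γ 1 1 : ℤ) * (g q 1 0 : ℤ) := by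
        simpa [γ'] using hqγ
      exact_mod_cast this
    obtain ⟨a, b, hab⟩ := hcop q
    obtain ⟨a', b', hab'⟩ := hcd
    -- Two primitive vectors on one line differ by a unit; Bézout coefficients of the second exhibit
    -- the factor as `a c + b d`.
    have hu : (a * c + b * d) * (a' * g q 1 0 + b' * g q 1 1) = 1 := by
      linear_combination (b * a' - a * b') * -h1 + hab' * (a * g q 1 0 + b * g q 1 1) + hab
    refine hv ⟨(q, Units.mkOfMulEqOne _ _ hu), Prod.ext ?_ ?_⟩
    · simp only [row, Units.val_mkOfMulEqOne]
      linear_combination c * hab - b * h1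
    · simp only [row, Units.val_mkOfMulEqOne]
      linear_combination d * hab + a * h1
  have hsum := (hinj.hasSum_iff hrange).mpr h
  have hterm : ∀ w, (if (p : ℤ) ∣ (row w).1 then coprimeTerm z s (row w) else 0) =
      eisensteinTerm (gammaZero p) OnePoint.infty τ z s w.1 := by
    rintro ⟨q, ε⟩
    have hε : ((ε : ℤ) : ℝ) ^ 2 = 1 := by
      rcases Int.units_eq_one_or ε with rfl | rfl <;> simp
    have hcop' : IsCoprime ((ε : ℤ) * g q 1 0) (ε * g q 1 1) := by
      rw [isCoprime_mul_unit_left ε.isUnit]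
      exact hcop q
    rw [if_pos ((hdvd q).mul_left _), coprimeTerm, if_pos hcop', eisensteinTerm, mul_smul,
      hτ.im_inv_smul, ← hgq, im_map_int_smul]
    have := latticeForm_mul z ε (g q 1 0, g q 1 1)
    rw [hε, one_mul] at this
    rw [← this]
  have h2 : HasSum (fun w : CuspCosets (gammaZero p) OnePoint.infty × ℤˣ =>
      eisensteinTerm (gammaZero p) OnePoint.infty τ z s w.1) S :=
    hsum.congr_fun fun w => (hterm w).symm
  have h3 := h2.prod_fiberwise (fun q => hasSum_fintype _)
  simp only [Finset.sum_const, Finset.card_univ, Fintype.card_units_int, nsmul_eq_mul] at h3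
  refine (h3.div_const 2).congr_fun fun q => ?_
  push_cast
  ring

/-! ### Transport along the normalizer and the Fricke involution -/

section

variable {Γ : Subgroup SL(2, ℝ)} {a b : OnePoint ℝ} {W τ : SL(2, ℝ)}

lemma IsScalingMatrix.mul_left (hW : ∀ γ, W * γ * W⁻¹ ∈ Γ ↔ γ ∈ Γ)
    (hab : (W : GL (Fin 2) ℝ) • a = b) (hτ : IsScalingMatrix Γ a τ) :
    IsScalingMatrix Γ b (W * τ) where
  map_infty := by rw [map_mul, mul_smul, hτ.map_infty, hab]
  conj_mem_iff x := by
    rw [← hτ.conj_mem_iff, ← hW (τ * unipotent x * τ⁻¹)]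
    simp only [mul_inv_rev, mul_assoc]

/-- The term may be computed at any representative, which allows comparison across a bijection of
cosets that does not respect the chosen ones. -/
lemma eisensteinTerm_mk (hτ : IsScalingMatrix Γ a τ) (z : UpperHalfPlane) (s : ℂ) (γ : Γ) :
    eisensteinTerm Γ a τ z s (Quotient.mk _ γ) =
      ((((τ⁻¹ * (γ : SL(2, ℝ))) • z : UpperHalfPlane).im : ℝ) : ℂ) ^ s := by
  obtain ⟨δ, hδ⟩ : ∃ δ : Γ, δ = (Quotient.mk (QuotientGroup.rightRel (cuspStabilizer Γ a)) γ).out :=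
    ⟨_, rfl⟩
  have hrel : γ * δ⁻¹ ∈ cuspStabilizer Γ a := by
    rw [hδ, ← QuotientGroup.rightRel_apply]
    exact Quotient.mk_out (s := QuotientGroup.rightRel (cuspStabilizer Γ a)) γ
  rw [eisensteinTerm, ← hδ, ← hτ.im_smul_eq _ hrel]
  simp

/-- Conjugation by an element normalizing `Γ`. -/
def normalizerConj (hW : ∀ γ, W * γ * W⁻¹ ∈ Γ ↔ γ ∈ Γ) : Γ ≃ Γ where
  toFun γ := ⟨W * γ * W⁻¹, (hW γ).mpr γ.2⟩
  invFun γ := ⟨W⁻¹ * γ * W, by rw [← hW]; simp [mul_assoc]⟩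
  left_inv γ := by ext : 1; simp [mul_assoc]
  right_inv γ := by ext : 1; simp [mul_assoc]

/-- Conjugation by `W` preserves `Γ` and carries the stabilizer of `a` to that of `b = W a`. -/
lemma exists_equiv_cuspCosets (hW : ∀ γ, W * γ * W⁻¹ ∈ Γ ↔ γ ∈ Γ)
    (hab : (W : GL (Fin 2) ℝ) • a = b) :
    ∃ e : CuspCosets Γ a ≃ CuspCosets Γ b, ∀ γ : Γ,
      e (Quotient.mk _ γ) = Quotient.mk _ (normalizerConj hW γ) := by
  refine ⟨Quotient.congr (normalizerConj hW) fun γ δ => ?_, fun γ => rfl⟩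
  rw [QuotientGroup.rightRel_apply, QuotientGroup.rightRel_apply]
  have h1 : ((normalizerConj hW δ * (normalizerConj hW γ)⁻¹ : Γ) : SL(2, ℝ)) =
      W * ((δ * γ⁻¹ : Γ) : SL(2, ℝ)) * W⁻¹ := by
    simp [normalizerConj, mul_assoc]
  change (((δ * γ⁻¹ : Γ) : SL(2, ℝ)) : GL (Fin 2) ℝ) • a = a ↔
    (((normalizerConj hW δ * (normalizerConj hW γ)⁻¹ : Γ) : SL(2, ℝ)) : GL (Fin 2) ℝ) • b = b
  rw [h1, ← hab, map_mul, map_mul, map_inv, mul_smul, mul_smul, inv_smul_smul, smul_left_cancel_iff]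

/-- An element normalizing `Γ` transports the Kronecker limits. -/
lemma HasKroneckerLimit.smul (hW : ∀ γ, W * γ * W⁻¹ ∈ Γ ↔ γ ∈ Γ)
    (hab : (W : GL (Fin 2) ℝ) • a = b) {z : UpperHalfPlane} {K : ℂ}
    (h : HasKroneckerLimit Γ a z K) : HasKroneckerLimit Γ b (W • z) K := by
  obtain ⟨⟨τ₀, hτ₀⟩, h⟩ := h
  refine ⟨⟨_, hτ₀.mul_left hW hab⟩, fun τ hτ => ?_⟩
  have hτ' : IsScalingMatrix Γ a (W⁻¹ * τ) := by
    refine hτ.mul_left (fun γ => ?_) ?_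
    · rw [← hW]
      simp [mul_assoc]
    · rw [map_inv, inv_smul_eq_iff, hab]
  obtain ⟨E, hE, hlim⟩ := h _ hτ'
  refine ⟨E, ⟨hE.meromorphic, fun s hs => ?_⟩, hlim⟩
  obtain ⟨e, he⟩ := exists_equiv_cuspCosets hW hab
  rw [← e.hasSum_iff]
  refine (hE.hasSum s hs).congr_fun fun q => ?_
  induction q using Quotient.inductionOn with
  | h γ =>
    rw [Function.comp_apply, he, eisensteinTerm_mk hτ, eisensteinTerm_mk hτ', ← mul_smul]
    simp [normalizerConj, mul_assoc]

end

/-- The Fricke involution. -/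
noncomputable def frickeMatrix (p : ℕ) [NeZero p] : SL(2, ℝ) :=
  ⟨!![0, -(√p)⁻¹; √p, 0], by
    have : √(p : ℝ) ≠ 0 := by simp [NeZero.ne p]
    simp [Matrix.det_fin_two, this]⟩

section

variable (p : ℕ) [NeZero p]

lemma coe_frickeMatrix :
    (frickeMatrix p : Matrix (Fin 2) (Fin 2) ℝ) = !![0, -(√p)⁻¹; √p, 0] := rfl

lemma frickeMatrix_conj (g : SL(2, ℝ)) :
    ((frickeMatrix p * g * (frickeMatrix p)⁻¹ : SL(2, ℝ)) : Matrix (Fin 2) (Fin 2) ℝ) =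
      !![g 1 1, -(g 1 0 / p); -(p * g 0 1), g 0 0] := by
  have h0 : √(p : ℝ) ≠ 0 := by simp [NeZero.ne p]
  have hp : (p : ℝ) ≠ 0 := Nat.cast_ne_zero.mpr (NeZero.ne p)
  have h1 : √(p : ℝ) * √p = p := Real.mul_self_sqrt (Nat.cast_nonneg p)
  rw [Matrix.SpecialLinearGroup.coe_mul, Matrix.SpecialLinearGroup.coe_mul,
    Matrix.SpecialLinearGroup.coe_inv, coe_frickeMatrix]
  conv_lhs => rw [Matrix.eta_fin_two (g : Matrix (Fin 2) (Fin 2) ℝ)]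
  rw [Matrix.adjugate_fin_two_of, Matrix.mul_fin_two, Matrix.mul_fin_two]
  ext i j
  fin_cases i <;> fin_cases j <;> simp <;> field_simp
  · linear_combination (-(g 1 0)) * h1
  · linear_combination g 0 1 * h1

lemma frickeMatrix_conj_mem_of_mem {γ : SL(2, ℝ)} (h : γ ∈ gammaZero p) :
    frickeMatrix p * γ * (frickeMatrix p)⁻¹ ∈ gammaZero p := by
  obtain ⟨g, hg, rfl⟩ := h
  have hdvd : (p : ℤ) ∣ g 1 0 := by
    have h := CongruenceSubgroup.Gamma0_mem.mp hg
    rwa [ZMod.intCast_zmod_eq_zero_iff_dvd] at h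
  obtain ⟨c, hc⟩ := hdvd
  have hdet := g.det_coe
  rw [Matrix.det_fin_two, hc] at hdet
  obtain ⟨g', hg'⟩ : ∃ g' : SL(2, ℤ), (g' : Matrix (Fin 2) (Fin 2) ℤ) =
      !![g 1 1, -c; -(p * g 0 1), g 0 0] :=
    ⟨⟨_, by rw [Matrix.det_fin_two_of]; linear_combination hdet⟩, rfl⟩
  refine ⟨g', ?_, ?_⟩
  · change g' ∈ CongruenceSubgroup.Gamma0 p
    rw [CongruenceSubgroup.Gamma0_mem, hg']
    simp
  · have hp : (p : ℝ) ≠ 0 := Nat.cast_ne_zero.mpr (NeZero.ne p)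
    apply Subtype.ext
    rw [frickeMatrix_conj, Matrix.SpecialLinearGroup.map_apply_coe,
      Matrix.SpecialLinearGroup.map_apply_coe, hg']
    ext i j
    fin_cases i <;> fin_cases j <;> simp [hc, hp]

lemma frickeMatrix_conj_mem (γ : SL(2, ℝ)) :
    frickeMatrix p * γ * (frickeMatrix p)⁻¹ ∈ gammaZero p ↔ γ ∈ gammaZero p := by
  refine ⟨fun h => ?_, frickeMatrix_conj_mem_of_mem p⟩
  -- Conjugating twice is the identity, because the square of the Fricke matrix is `-1`.
  convert frickeMatrix_conj_mem_of_mem p h using 1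
  have := NeZero.ne p
  apply Subtype.ext
  rw [frickeMatrix_conj, frickeMatrix_conj]
  ext i j
  fin_cases i <;> fin_cases j <;> simp <;> field_simp

lemma frickeMatrix_smul_infty : (frickeMatrix p : GL (Fin 2) ℝ) • (OnePoint.infty : OnePoint ℝ) =
    ((0 : ℝ) : OnePoint ℝ) := by
  have h0 : √(p : ℝ) ≠ 0 := by simp [NeZero.ne p]
  rw [OnePoint.smul_infty_eq_ite]
  simp [h0, coe_frickeMatrix]

lemma coe_frickeMatrix_smul (z : UpperHalfPlane) :
    ((frickeMatrix p • z : UpperHalfPlane) : ℂ) = -1 / (p * z) := by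
  have h0 : (√(p : ℝ) : ℂ) ≠ 0 := by simp [NeZero.ne p]
  have h1 : (√(p : ℝ) : ℂ) * √p = p := by
    exact_mod_cast Real.mul_self_sqrt (Nat.cast_nonneg p)
  have hz := z.ne_zero
  rw [UpperHalfPlane.coe_specialLinearGroup_apply, ← h1]
  simp only [coe_frickeMatrix]
  simp
  field_simp

end

lemma latticeForm_of_coe_eq_neg_inv {z w : UpperHalfPlane} (h : (w : ℂ) = -1 / z) (v : ℤ × ℤ) :
    latticeForm w (-v.2, v.1) = latticeForm z v := by
  have hz := z.ne_zero
  have him : w.im = z.im / Complex.normSq z := by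
    have : w.im = (-1 / (z : ℂ)).im := congrArg Complex.im h
    rw [this, neg_div, one_div, Complex.neg_im, Complex.inv_im]
    simp [neg_div]
  have hn : Complex.normSq (z : ℂ) ≠ 0 := by simpa using hz
  have hy := z.im_pos.ne'
  have e : ((-v.2 : ℤ) : ℂ) * w + (v.1 : ℤ) = (v.1 * z + v.2) / z := by
    rw [h]
    push_cast
    field_simp
    ring
  rw [latticeForm, latticeForm]
  simp only
  rw [e, him, Complex.normSq_div]
  field_simp

/-- The rotation `(m, n) ↦ (-n, m)` of the lattice matches the two forms. Comparing theta series
rather than Dirichlet series gives the equality for all `s`, not only for `Re s > 1`. -/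
lemma epsteinZeta_of_coe_eq_neg_inv {z w : UpperHalfPlane} (h : (w : ℂ) = -1 / z) :
    epsteinZeta w = epsteinZeta z := by
  let e : ℤ × ℤ ≃ ℤ × ℤ :=
    ⟨fun v => (-v.2, v.1), fun v => (v.2, -v.1), fun v => by simp, fun v => by simp⟩
  have hθ : latticeTheta w = latticeTheta z := by
    funext t
    rw [latticeTheta, latticeTheta, ← e.tsum_eq]
    congr 1
    refine tsum_congr fun v => ?_
    have h0 : e v = 0 ↔ v = 0 := by
      simp [e, Prod.ext_iff, and_comm]
    have h1 : latticeForm w (e v) = latticeForm z v := latticeForm_of_coe_eq_neg_inv h v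
    simp only [thetaTerm, h0, h1]
  have hpair : latticeThetaFEPair w = latticeThetaFEPair z := by
    simp only [latticeThetaFEPair, hθ]
  funext s
  rw [epsteinZeta, epsteinZeta, hpair]

/-! ### The continued Eisenstein series near `s = 1` -/

lemma meromorphicAt_riemannZeta_two_mul (s : ℂ) :
    MeromorphicAt (fun s => riemannZeta (2 * s)) s := by
  have h1 : Differentiable ℂ fun s : ℂ => riemannZeta₁ (2 * s) :=
    differentiable_riemannZeta₁.comp (differentiable_id.const_mul 2)
  have h2 : Differentiable ℂ fun s : ℂ => 2 * s - 1 := (differentiable_id.const_mul 2).sub_const 1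
  refine ((h2.analyticAt s).meromorphicAt.inv.mul (h1.analyticAt s).meromorphicAt).congr ?_
  have h3 : ∀ᶠ w in 𝓝[≠] s, w ≠ 1 / 2 := by
    by_cases hs : s = 1 / 2
    · rw [hs]
      exact self_mem_nhdsWithin
    · exact eventually_nhdsWithin_of_eventually_nhds (eventually_ne_nhds hs)
  filter_upwards [h3] with w hw
  have hw2 : 2 * w ≠ 1 := fun h => hw (by rw [← h]; ring)
  exact (riemannZeta_eq_inv_sub_mul hw2).symm

/-- The continued Eisenstein series of `Γ₀(p)` in terms of two Epstein zeta functions. -/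
noncomputable def eisensteinContinuation (p : ℕ) (e₁ e₂ : ℂ → ℂ) (s : ℂ) : ℂ :=
  ((p : ℂ) ^ s * e₁ s - e₂ s) / (riemannZeta (2 * s) * (((p : ℂ) ^ s) ^ 2 - 1)) / 2

section

variable {p : ℕ} {e₁ e₂ : ℂ → ℂ}

lemma meromorphicOn_eisensteinContinuation (hp : p ≠ 0) (h₁ : ∀ s, MeromorphicAt e₁ s)
    (h₂ : ∀ s, MeromorphicAt e₂ s) :
    MeromorphicOn (eisensteinContinuation p e₁ e₂) Set.univ := by
  intro s _
  have hpow : MeromorphicAt (fun s => (p : ℂ) ^ s) s :=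
    ((differentiable_id.const_cpow (Or.inl (Nat.cast_ne_zero.mpr hp))).analyticAt s).meromorphicAt
  exact ((((hpow.mul (h₁ s)).sub (h₂ s)).div ((meromorphicAt_riemannZeta_two_mul s).mul
    ((hpow.pow 2).sub (MeromorphicAt.const 1 s)))).div (MeromorphicAt.const 2 s))

lemma hasDerivAt_riemannZeta_two_mul_mul (hp : p ≠ 0) :
    HasDerivAt (fun s : ℂ => 2 * (riemannZeta (2 * s) * ((p : ℂ) ^ s + 1)))
      (2 * (2 * deriv riemannZeta 2 * (p + 1) + riemannZeta 2 * (p * Complex.log p))) 1 := by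
  have hz : HasDerivAt (fun s : ℂ => riemannZeta (2 * s)) (deriv riemannZeta 2 * 2) 1 := by
    have h1 : HasDerivAt riemannZeta (deriv riemannZeta 2) (2 * 1) := by
      rw [mul_one]
      exact (differentiableAt_riemannZeta (by norm_num)).hasDerivAt
    have h2 : HasDerivAt (fun s : ℂ => 2 * s) 2 1 := by
      simpa using (hasDerivAt_id (1 : ℂ)).const_mul 2
    exact h1.comp 1 h2
  have hpow : HasDerivAt (fun s : ℂ => (p : ℂ) ^ s + 1) (p * Complex.log p) 1 := by
    have := ((hasDerivAt_id (1 : ℂ)).const_cpow (c := (p : ℂ))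
      (Or.inl (Nat.cast_ne_zero.mpr hp))).add_const 1
    simpa using this
  refine ((hz.mul hpow).const_mul 2).congr_deriv ?_
  rw [mul_one, Complex.cpow_one]
  ring

/-- The poles `π / (s - 1)` of `e₁` and `e₂` combine to `π (p ^ s - 1) / (s - 1)` in the numerator.
The factor `p ^ s - 1` cancels against `p ^ (2s) - 1`, leaving `π / ((s - 1) D s)` with `D s = 2
ζ(2s) (p ^ s + 1)`. As `ζ(2) = π² / 6`, the residue `π / D 1` is `3 / ((p + 1) π)`, the reciprocal
of the area. -/
lemma tendsto_eisensteinContinuation_sub (hp : 1 < p) {A B : ℂ}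
    (h₁ : Tendsto (fun s => e₁ s - Real.pi / (s - 1)) (𝓝[≠] 1) (𝓝 A))
    (h₂ : Tendsto (fun s => e₂ s - Real.pi / (s - 1)) (𝓝[≠] 1) (𝓝 B)) :
    Tendsto (fun s => eisensteinContinuation p e₁ e₂ s -
        1 / ((((p + 1) * Real.pi / 3 : ℝ) : ℂ) * (s - 1))) (𝓝[≠] 1)
      (𝓝 ((p * A - B) * (3 / (Real.pi ^ 2 * (p ^ 2 - 1))) -
        3 / ((p + 1) * Real.pi) * (2 * (deriv riemannZeta 2 / riemannZeta 2) +
          p * Complex.log p / (p + 1)))) := by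
  have hp0 : p ≠ 0 := by lia
  have hpi : (Real.pi : ℂ) ≠ 0 := Complex.ofReal_ne_zero.mpr Real.pi_ne_zero
  have hp1 : (p : ℂ) + 1 ≠ 0 := by exact_mod_cast (by lia : p + 1 ≠ 0)
  have hpm : (p : ℂ) - 1 ≠ 0 := sub_ne_zero.mpr (by exact_mod_cast hp.ne')
  have hp2 : (p : ℂ) ^ 2 - 1 ≠ 0 := by
    have : (p : ℂ) ^ 2 - 1 = (p + 1) * (p - 1) := by ring
    rw [this]
    exact mul_ne_zero hp1 hpm
  have hz2 := riemannZeta_two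
  have hz20 : riemannZeta 2 ≠ 0 := by
    rw [hz2]
    exact div_ne_zero (pow_ne_zero 2 hpi) (by norm_num)
  obtain ⟨D, hD⟩ : ∃ D : ℂ → ℂ, ∀ s, D s = 2 * (riemannZeta (2 * s) * ((p : ℂ) ^ s + 1)) :=
    ⟨_, fun _ => rfl⟩
  have hDd : HasDerivAt D (2 * (2 * deriv riemannZeta 2 * (p + 1) +
      riemannZeta 2 * (p * Complex.log p))) 1 := by
    have := hasDerivAt_riemannZeta_two_mul_mul hp0
    rwa [← funext hD] at this
  have hD1 : D 1 = 2 * (riemannZeta 2 * (p + 1)) := by simp [hD]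
  have hD0 : D 1 ≠ 0 := by
    rw [hD1]
    exact mul_ne_zero two_ne_zero (mul_ne_zero hz20 hp1)
  have hslope := (hDd.inv hD0).tendsto_slope
  have hc : ContinuousAt (fun s : ℂ => (p : ℂ) ^ s) 1 :=
    (continuous_id.const_cpow (Or.inl (Nat.cast_ne_zero.mpr hp0))).continuousAt
  have hζ : ContinuousAt (fun s : ℂ => riemannZeta (2 * s)) 1 := by
    refine ContinuousAt.comp (g := riemannZeta) ?_ (continuous_const.mul continuous_id).continuousAt
    exact (differentiableAt_riemannZeta (by norm_num)).continuousAt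
  have hG : ContinuousAt (fun s : ℂ => (riemannZeta (2 * s) * (((p : ℂ) ^ s) ^ 2 - 1) * 2)⁻¹) 1 := by
    refine ((hζ.mul ((hc.pow 2).sub continuousAt_const)).mul continuousAt_const).inv₀ ?_
    simpa using ⟨hz20, hp2⟩
  have hlim := (hG.tendsto.mono_left nhdsWithin_le_nhds).mul
    (((hc.tendsto.mono_left nhdsWithin_le_nhds).mul h₁).sub h₂)
  -- The first summand comes from the finite parts `A` and `B`; the second is what is left of the
  -- poles, a difference quotient of `1 / D`.
  have hlim2 := hlim.add (hslope.const_mul (Real.pi : ℂ))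
  have hval : ((p * A - B) * (3 / (Real.pi ^ 2 * (p ^ 2 - 1))) -
        3 / ((p + 1) * Real.pi) * (2 * (deriv riemannZeta 2 / riemannZeta 2) +
          p * Complex.log p / (p + 1))) =
      (riemannZeta (2 * 1) * (((p : ℂ) ^ (1 : ℂ)) ^ 2 - 1) * 2)⁻¹ * ((p : ℂ) ^ (1 : ℂ) * A - B) +
        Real.pi * (-(2 * (2 * deriv riemannZeta 2 * (p + 1) +
          riemannZeta 2 * (p * Complex.log p))) / D 1 ^ 2) := by
    rw [hD1, mul_one, Complex.cpow_one, hz2]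
    field_simp
    ring
  rw [hval]
  refine hlim2.congr' ?_
  have hre : ∀ᶠ s : ℂ in 𝓝[≠] 1, 0 < s.re := by
    apply eventually_nhdsWithin_of_eventually_nhds
    exact Complex.continuous_re.continuousAt.eventually (lt_mem_nhds (by simp))
  have hDs : ∀ᶠ s : ℂ in 𝓝[≠] 1, D s ≠ 0 :=
    eventually_nhdsWithin_of_eventually_nhds (hDd.continuousAt.eventually_ne hD0)
  filter_upwards [hre, hDs, self_mem_nhdsWithin] with s hs hDs0 hs1
  have hs1' : s - 1 ≠ 0 := sub_ne_zero.mpr hs1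
  have hps : (p : ℂ) ^ s - 1 ≠ 0 := by
    intro h
    have h1 := norm_natCast_cpow_gt_one hp hs
    rw [sub_eq_zero.mp h, norm_one] at h1
    exact lt_irrefl _ h1
  rw [hD] at hDs0
  have hζs : riemannZeta (2 * s) ≠ 0 := left_ne_zero_of_mul (right_ne_zero_of_mul hDs0)
  have hps1 : (p : ℂ) ^ s + 1 ≠ 0 := right_ne_zero_of_mul (right_ne_zero_of_mul hDs0)
  rw [slope_def_field, eisensteinContinuation]
  simp only [Pi.inv_apply]
  rw [hD1, hD, hz2]
  have hsq : ((p : ℂ) ^ s) ^ 2 - 1 = ((p : ℂ) ^ s + 1) * ((p : ℂ) ^ s - 1) := by ring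
  rw [hsq]
  generalize (p : ℂ) ^ s = x at *
  push_cast
  field_simp
  ring

end

/-! ### The limits for the two cusps -/

/-- The Kronecker limits of `Γ₀(p)` for the cusp `∞`. -/
lemma hasKroneckerLimit_infty {p : ℕ} (hp : p.Prime) [NeZero p] (z : UpperHalfPlane) {A B : ℂ}
    (h₁ : Tendsto (fun s => epsteinZeta (scaledPoint p z) s - Real.pi / (s - 1)) (𝓝[≠] 1) (𝓝 A))
    (h₂ : Tendsto (fun s => epsteinZeta z s - Real.pi / (s - 1)) (𝓝[≠] 1) (𝓝 B)) :
    HasKroneckerLimit (gammaZero p) OnePoint.infty z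
      ((p * A - B) * (3 / (Real.pi ^ 2 * (p ^ 2 - 1))) -
        3 / ((p + 1) * Real.pi) * (2 * (deriv riemannZeta 2 / riemannZeta 2) +
          p * Complex.log p / (p + 1))) := by
  refine ⟨⟨1, isScalingMatrix_one p⟩, fun τ hτ =>
    ⟨eisensteinContinuation p (epsteinZeta (scaledPoint p z)) (epsteinZeta z),
      ⟨meromorphicOn_eisensteinContinuation hp.ne_zero (meromorphic_epsteinZeta _)
        (meromorphic_epsteinZeta _), fun s hs =>
          hasSum_eisensteinTerm_infty hτ z (hasSum_coprimeTerm_dvd hp z hs)⟩, ?_⟩⟩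
  rw [hyperbolicArea_gammaZero hp]
  exact tendsto_eisensteinContinuation_sub hp.one_lt h₁ h₂

lemma log_mul_rpow_div_rpow {y a b : ℝ} (hy : 0 < y) (ha : 0 < a) (hb : 0 < b) (r t : ℝ) :
    Real.log (4 * y * a ^ r / b ^ t) =
      2 * Real.log 2 + Real.log y + r * Real.log a - t * Real.log b := by
  have h4 : Real.log 4 = 2 * Real.log 2 := by
    rw [show (4 : ℝ) = 2 ^ 2 by norm_num, Real.log_pow]
    push_cast
    rfl
  have h1 := Real.rpow_pos_of_pos ha r
  have h2 := Real.rpow_pos_of_pos hb t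
  rw [Real.log_div (by positivity) h2.ne', Real.log_mul (by positivity) h1.ne',
    Real.log_mul (by norm_num) hy.ne', Real.log_rpow ha, Real.log_rpow hb, h4]

lemma norm_eta_pos (z : UpperHalfPlane) : 0 < ‖ModularForm.eta (z : ℂ)‖ :=
  norm_pos_iff.mpr (ModularForm.eta_ne_zero z.im_pos)

end

theorem propositionp (p : ℕ) (hp : p.Prime) (z : UpperHalfPlane) :
    HasKroneckerLimit (gammaZero p) OnePoint.infty z
      ((3 / (((p : ℂ) + 1) * (Real.pi : ℂ))) *
        (2 * (Real.eulerMascheroniConstant : ℂ) - 2 * (deriv riemannZeta 2 / riemannZeta 2)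
          - (Real.log (4 * z.im
              * ‖ModularForm.eta ((p : ℂ) * (z : ℂ))‖ ^ (4 * (p : ℝ) / ((p : ℝ) - 1))
              / ‖ModularForm.eta (z : ℂ)‖ ^ (4 / ((p : ℝ) - 1))) : ℂ)
          - ((2 * (p : ℝ) ^ 2 * Real.log p / ((p : ℝ) ^ 2 - 1) : ℝ) : ℂ))) ∧
    HasKroneckerLimit (gammaZero p) ((0 : ℝ) : OnePoint ℝ) z
      ((3 / (((p : ℂ) + 1) * (Real.pi : ℂ))) *
        (2 * (Real.eulerMascheroniConstant : ℂ) - 2 * (deriv riemannZeta 2 / riemannZeta 2)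
          - (Real.log (4 * z.im
              * ‖ModularForm.eta (z : ℂ)‖ ^ (4 * (p : ℝ) / ((p : ℝ) - 1))
              / ‖ModularForm.eta ((p : ℂ) * (z : ℂ))‖ ^ (4 / ((p : ℝ) - 1))) : ℂ)
          + (((1 + 2 * (p : ℝ) - (p : ℝ) ^ 2) * Real.log p / ((p : ℝ) ^ 2 - 1) : ℝ) : ℂ))) := by
  have : NeZero p := ⟨hp.ne_zero⟩
  have hpi : (Real.pi : ℂ) ≠ 0 := Complex.ofReal_ne_zero.mpr Real.pi_ne_zero
  have hp1 : (p : ℂ) + 1 ≠ 0 := by exact_mod_cast (by lia : p + 1 ≠ 0)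
  have hpm : (p : ℂ) - 1 ≠ 0 := sub_ne_zero.mpr (by exact_mod_cast hp.one_lt.ne')
  have hsq : (p : ℂ) ^ 2 - 1 = (p + 1) * (p - 1) := by ring
  have hp0 : (0 : ℝ) < p := by exact_mod_cast hp.pos
  have hA := tendsto_epsteinZeta_sub (scaledPoint p z)
  have hB := tendsto_epsteinZeta_sub z
  have hη₁ : 0 < ‖ModularForm.eta ((p : ℂ) * (z : ℂ))‖ := norm_eta_pos (scaledPoint p z)
  have hη₂ := norm_eta_pos z
  have hcoe : ((scaledPoint p z : UpperHalfPlane) : ℂ) = p * z := rfl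
  -- Splitting `log (p y)` yields an extra `log p`. Together with the `p log p / (p + 1)` from the
  -- denominator it makes up the last term of each formula.
  rw [scaledPoint_im, hcoe, Real.log_mul hp0.ne' z.im_pos.ne'] at hA
  rw [log_mul_rpow_div_rpow z.im_pos hη₁ hη₂, log_mul_rpow_div_rpow z.im_pos hη₂ hη₁]
  have hlog : Complex.log (p : ℂ) = ((Real.log p : ℝ) : ℂ) := by
    rw [← Complex.ofReal_natCast, Complex.ofReal_log hp0.le]
  constructor
  · convert! hasKroneckerLimit_infty hp z hA hB using 1
    rw [hlog]
    push_cast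
    rw [hsq]
    field_simp
    ring
  · obtain ⟨w, hw⟩ : ∃ w, frickeMatrix p • w = z := ⟨_, smul_inv_smul _ z⟩
    -- With `z = -1 / (p w)` the point `p w` is `-1 / z`, and `w` is `-1 / (p z)`: the Epstein zeta
    -- functions at `p w` and `w` are those at `z` and `p z`.
    have hwz : (z : ℂ) = -1 / (p * w) := by rw [← hw, coe_frickeMatrix_smul]
    have hp0' : (p : ℂ) ≠ 0 := Nat.cast_ne_zero.mpr hp.ne_zero
    have hw0 := w.ne_zero
    have h1 : epsteinZeta (scaledPoint p w) = epsteinZeta z :=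
      (epsteinZeta_of_coe_eq_neg_inv hwz).symm
    have h2 : epsteinZeta w = epsteinZeta (scaledPoint p z) := by
      refine epsteinZeta_of_coe_eq_neg_inv ?_
      rw [hcoe, hwz]
      field_simp
    have h := hasKroneckerLimit_infty hp w (by rw [h1]; exact hB) (by rw [h2]; exact hA)
    convert! HasKroneckerLimit.smul (frickeMatrix_conj_mem p) (frickeMatrix_smul_infty p) h using 1
    · exact hw.symm
    rw [hlog]
    push_cast
    rw [hsq]
    field_simp
    ring
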